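/- Graphs are finite and may contain parallel edges but no loops. For distinct vertices $s,t$ of a graph $G$, an $s$-$t$ disconnecting pair is a pair $(W,F)$ with $W\subseteq V(G)\setminus\{s,t\}$ and $F\subseteq E(G)$ such that $G-W-F$ contains no $s$-$t$ path. A pair $(k,l)$ of non-negative integers is a connectivity pair for $s$ and $t$ in $G$ if there is an $s$-$t$ disconnecting pair $(W,F)$ with $|W|=k$ and $|F|=l$, and there is no $s$-$t$ disconnecting pair $(W,F)$ with $|W|\le k$, $|F|\le l$ and $|W|+|F|<k+l$. Theorem. Let $G$ be a graph of treewidth at most $2$, let $s,t\in V(G)$ be distinct vertices, and let $k\ge 0$ and $l\ge 1$ be integers. If $(k,l)$ is a connectivity pair for $s$ and $t$ in $G$, then $G$ contains $k+l$ pairwise edge-disjoint $s$-$t$ paths, of which $k+1$ are pairwise internally disjoint (that is, any two of these $k+1$ paths share no vertices other than $s$ and $t$). -/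

import Mathlib

namespace Graph

/-- A walk in the multigraph `G`, recording the vertices and the edges that it traverses
(so that parallel edges give different walks). -/
inductive Walk {α : Type*} {β : Type*} (G : Graph α β) : α → α → Type _
  | nil (x : α) (hx : x ∈ G.vertexSet) : Walk G x x
  | cons {x y z : α} (e : β) (h : G.IsLink e x y) (w : Walk G y z) : Walk G x z

/-- The list of vertices of a walk, in order. -/
def Walk.support {α : Type*} {β : Type*} {G : Graph α β} : {x y : α} → G.Walk x y → List α
  | _, _, .nil x _ => [x]
  | x, _, .cons _ _ w => x :: w.support

/-- The list of edges of a walk, in order. -/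
def Walk.edges {α : Type*} {β : Type*} {G : Graph α β} : {x y : α} → G.Walk x y → List β
  | _, _, .nil _ _ => []
  | _, _, .cons e _ w => e :: w.edges

/-- A walk from `x` to `y` is an `x`-`y` path if its vertices are pairwise distinct. -/
def Walk.IsPath {α : Type*} {β : Type*} {G : Graph α β} {x y : α} (p : G.Walk x y) : Prop :=
  p.support.Nodup

/-- Two walks are edge-disjoint if no edge is used by both. -/
def Walk.EdgeDisjoint {α : Type*} {β : Type*} {G : Graph α β} {x y : α}
    (p q : G.Walk x y) : Prop :=
  ∀ e, e ∈ p.edges → e ∉ q.edges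

/-- Two `x`-`y` walks are internally disjoint if they share no vertices except `x` and `y`. -/
def Walk.InternallyDisjoint {α : Type*} {β : Type*} {G : Graph α β} {x y : α}
    (p q : G.Walk x y) : Prop :=
  ∀ v, v ∈ p.support → v ∈ q.support → v = x ∨ v = y

/-- `(W, F)` is an `s`-`t` disconnecting pair: `W` is a set of vertices other than `s`, `t`,
`F` is a set of edges, and `G - W - F` contains no `s`-`t` path. -/
def IsDisconnectingPair {α : Type*} {β : Type*} (G : Graph α β) (s t : α)
    (W : Set α) (F : Set β) : Prop :=
  W ⊆ G.vertexSet \ {s, t} ∧ F ⊆ G.edgeSet ∧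
    ¬ ∃ p : ((G.deleteVerts W).deleteEdges F).Walk s t, p.IsPath

/-- `(k, l)` is a connectivity pair for `s` and `t`: there is a disconnecting pair with exactly
`k` vertices and `l` edges, and none of smaller cardinality with at most `k` vertices and at
most `l` edges. -/
def IsConnectivityPair {α : Type*} {β : Type*} (G : Graph α β) (s t : α) (k l : ℕ) : Prop :=
  (∃ (W : Finset α) (F : Finset β), G.IsDisconnectingPair s t (W : Set α) (F : Set β) ∧
      W.card = k ∧ F.card = l) ∧
    ¬ ∃ (W : Finset α) (F : Finset β), G.IsDisconnectingPair s t (W : Set α) (F : Set β) ∧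
      W.card ≤ k ∧ F.card ≤ l ∧ W.card + F.card < k + l

/-- A tree decomposition of `G` with nodes of the tree indexed by `ι`. -/
structure TreeDecomposition {α : Type*} {β : Type*} (G : Graph α β) (ι : Type*) where
  /-- The tree. -/
  tree : SimpleGraph ι
  isTree : tree.IsTree
  /-- The bags. -/
  bag : ι → Set α
  iUnion_bag : ⋃ i, bag i = G.vertexSet
  exists_bag_of_isLink : ∀ e x y, G.IsLink e x y → ∃ i, x ∈ bag i ∧ y ∈ bag i
  mem_bag_of_mem_path : ∀ (v : α) (i j : ι), v ∈ bag i → v ∈ bag j →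
    ∀ p : tree.Walk i j, p.IsPath → ∀ m ∈ p.support, v ∈ bag m

/-- The width of a tree decomposition: the maximal size of a bag, minus one. -/
noncomputable def TreeDecomposition.width {α : Type*} {β : Type*} {G : Graph α β} {ι : Type*}
    (D : G.TreeDecomposition ι) : ℕ∞ :=
  (⨆ i, (D.bag i).encard) - 1

/-- The treewidth of `G`: the minimal width of a tree decomposition over a finite tree. -/
noncomputable def treewidth {α : Type*} {β : Type*} (G : Graph α β) : ℕ∞ :=
  sInf {w : ℕ∞ | ∃ (ι : Type) (_ : Finite ι) (D : G.TreeDecomposition ι), D.width = w}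

end Graph

/-! Minimality of `(k, l)` has two consequences. No fewer than `k + l` edges separate `s` from `t`:
in a smaller edge cut with more than `l` edges, all but `l` of them could be traded for inner end
vertices, giving a smaller disconnecting pair. And since `l ≥ 1`, the vertex version of Menger's
theorem yields `k + 1` internally disjoint paths.

For `k ≥ 1` it remains to find `l - 1` edge-disjoint paths that avoid the edges of those `k + 1`
paths. If edges `F` destroy all `s`-`t` walks among the remaining edges, let `S` be the part still
reached from `s` and `T` the component of `t` outside `S`. The boundary of `T` is a bond with at
least `k + l` edges, each in `F` or on one of the chosen paths. Treewidth at most two forces each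
chosen path to cross the bond only once (`Graph.Walk.boundary_subsingleton`), so `F` has at least `l
- 1` edges, and the edge version of Menger's theorem finishes the proof.

A path crossing the bond more than once would visit `S, T, S, T` in this order. Together with a
second chosen path it forms a cycle, on which the connected sets `S` and `T` join crossing pairs.
This produces a `K₄` minor (`hasFourClique_of_crossing`), which the Helly property of subtrees
excludes (`false_of_four_connectedOn`). -/

namespace SimpleGraph

/-! ### Helly property of connected sets in a forest. -/

/-- `y` can be reached from `x` by a walk that stays in `S`. -/
def ReachableIn {V : Type*} (H : SimpleGraph V) (S : Set V) (x y : V) : Prop :=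
  ∃ w : H.Walk x y, ∀ v ∈ w.support, v ∈ S

/-- Any two vertices of `S` are joined by a walk that stays in `S`. -/
def ConnectedOn {V : Type*} (H : SimpleGraph V) (S : Set V) : Prop :=
  ∀ x ∈ S, ∀ y ∈ S, H.ReachableIn S x y

section

variable {V : Type*} {H : SimpleGraph V} {S T A B C : Set V} {x y z : V}

theorem ReachableIn.refl (hx : x ∈ S) : H.ReachableIn S x x := ⟨.nil, by simpa using hx⟩

theorem ReachableIn.symm (h : H.ReachableIn S x y) : H.ReachableIn S y x := by
  obtain ⟨w, hw⟩ := h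
  exact ⟨w.reverse, by simpa using hw⟩

theorem ReachableIn.trans (h : H.ReachableIn S x y) (h' : H.ReachableIn S y z) :
    H.ReachableIn S x z := by
  obtain ⟨w, hw⟩ := h
  obtain ⟨w', hw'⟩ := h'
  refine ⟨w.append w', fun v hv => ?_⟩
  rcases (Walk.mem_support_append_iff _ _).1 hv with h | h
  exacts [hw v h, hw' v h]

theorem ReachableIn.mono (h : H.ReachableIn S x y) (hST : S ⊆ T) : H.ReachableIn T x y :=
  h.imp fun _ hw v hv => hST (hw v hv)

theorem ReachableIn.of_adj (h : H.Adj x y) (hx : x ∈ S) (hy : y ∈ S) : H.ReachableIn S x y :=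
  ⟨.cons h .nil, by simp [hx, hy]⟩

theorem ReachableIn.left_mem (h : H.ReachableIn S x y) : x ∈ S := by
  obtain ⟨w, hw⟩ := h
  exact hw x w.start_mem_support

theorem ReachableIn.right_mem (h : H.ReachableIn S x y) : y ∈ S := h.symm.left_mem

theorem ConnectedOn.singleton (x : V) : H.ConnectedOn {x} := by
  rintro _ rfl _ rfl
  exact .refl rfl

theorem ConnectedOn.union_of_adj (hS : H.ConnectedOn S) (hT : H.ConnectedOn T)
    (hx : x ∈ S) (hy : y ∈ T) (h : H.Adj x y) : H.ConnectedOn (S ∪ T) := by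
  have hxy : H.ReachableIn (S ∪ T) x y := .of_adj h (.inl hx) (.inr hy)
  have key : ∀ z ∈ S ∪ T, H.ReachableIn (S ∪ T) z x := by
    rintro z (hz | hz)
    · exact (hS z hz x hx).mono Set.subset_union_left
    · exact ((hT z hz y hy).mono Set.subset_union_right).trans hxy.symm
  exact fun z hz w hw => (key z hz).trans (key w hw).symm

/-- Paths in a forest are unique, so `p` is the bypass of any walk that stays in `S`. -/
theorem ReachableIn.support_subset (hH : H.IsAcyclic) (h : H.ReachableIn S x y)
    {p : H.Walk x y} (hp : p.IsPath) : ∀ v ∈ p.support, v ∈ S := by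
  classical
  obtain ⟨w, hw⟩ := h
  have : p = w.bypass :=
    congrArg Subtype.val ((hH.subsingleton_path x y).elim ⟨p, hp⟩ ⟨w.bypass, w.bypass_isPath⟩)
  subst this
  exact fun v hv => hw v (w.support_bypass_subset_support hv)

theorem ReachableIn.exists_isPath (h : H.ReachableIn S x y) :
    ∃ p : H.Walk x y, p.IsPath ∧ ∀ v ∈ p.support, v ∈ S := by
  classical
  obtain ⟨w, hw⟩ := h
  exact ⟨w.bypass, w.bypass_isPath, fun v hv => hw v (w.support_bypass_subset_support hv)⟩

theorem ConnectedOn.inter (hH : H.IsAcyclic) (hA : H.ConnectedOn A) (hB : H.ConnectedOn B) :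
    H.ConnectedOn (A ∩ B) := by
  rintro x ⟨hxA, hxB⟩ y ⟨hyA, hyB⟩
  obtain ⟨p, hp, hpA⟩ := (hA x hxA y hyA).exists_isPath
  exact ⟨p, fun v hv => ⟨hpA v hv, (hB x hxB y hyB).support_subset hH hp v hv⟩⟩

theorem ConnectedOn.exists_mem_inter_of_walk (hH : H.IsAcyclic) (hA : H.ConnectedOn A)
    (hB : H.ConnectedOn B) (hAB : (A ∩ B).Nonempty) (p : H.Walk x y) (hx : x ∈ A) (hy : y ∈ B)
    (hp : ∀ v ∈ p.support, v ∈ A ∪ B) : ∃ v ∈ p.support, v ∈ A ∩ B := by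
  induction p with
  | nil => exact ⟨_, by simp, hx, hy⟩
  | @cons x x' y h p ih =>
    by_cases hxB : x ∈ B
    · exact ⟨x, by simp, hx, hxB⟩
    by_cases hx' : x' ∈ A
    · obtain ⟨v, hv, hvAB⟩ := ih hx' hy fun v hv => hp v (by simp [hv])
      exact ⟨v, by simp [hv], hvAB⟩
    have hx'B : x' ∈ B := (hp x' (by simp)).resolve_left hx'
    obtain ⟨u, huA, huB⟩ := hAB
    -- The walk leaves `A` along `x x'`. The path from `x'` through `x` and on inside `A` to `u`
    -- joins two points of `B`, so uniqueness puts `x` in `B`.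
    obtain ⟨q, hq, hqA⟩ := (hA x hx u huA).exists_isPath
    have hq' : (Walk.cons h.symm q).IsPath := hq.cons fun h => hx' (hqA _ h)
    exact absurd ((hB x' hx'B u huB).support_subset hH hq' x (by simp)) hxB

/-- The path inside `C` from `A` to `B` must also run inside `A ∪ B`, which is connected through a
point of `A ∩ B`; hence it passes through `A ∩ B`. -/
theorem ConnectedOn.inter_inter_nonempty (hH : H.IsAcyclic) (hA : H.ConnectedOn A)
    (hB : H.ConnectedOn B) (hC : H.ConnectedOn C) (hAB : (A ∩ B).Nonempty)
    (hAC : (A ∩ C).Nonempty) (hBC : (B ∩ C).Nonempty) : ((A ∩ B) ∩ C).Nonempty := by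
  obtain ⟨x, hxA, hxB⟩ := id hAB
  obtain ⟨z, hzA, hzC⟩ := hAC
  obtain ⟨y, hyB, hyC⟩ := hBC
  obtain ⟨p, hp, hpC⟩ := (hC z hzC y hyC).exists_isPath
  have hzy : H.ReachableIn (A ∪ B) z y :=
    ((hA z hzA x hxA).mono Set.subset_union_left).trans
      ((hB x hxB y hyB).mono Set.subset_union_right)
  obtain ⟨v, hv, hvAB⟩ := hA.exists_mem_inter_of_walk hH hB hAB p hzA hyB
    (hzy.support_subset hH hp)
  exact ⟨v, hvAB, hpC v hv⟩

/-- Reduces to three sets by intersecting everything with `X 0`; these traces are connected and meet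
pairwise by the three-set case. -/
theorem exists_mem_of_four_connectedOn (hH : H.IsAcyclic) (X : Fin 4 → Set V)
    (hX : ∀ i, H.ConnectedOn (X i)) (hXX : ∀ i j, (X i ∩ X j).Nonempty) :
    ∃ v, ∀ i, v ∈ X i := by
  have h1 := fun i => (hX 0).inter hH (hX i)
  have h2 := fun i j => (hX 0).inter_inter_nonempty hH (hX i) (hX j) (hXX _ _) (hXX _ _) (hXX i j)
  have h3 : ∀ i j, ((X 0 ∩ X i) ∩ (X 0 ∩ X j)).Nonempty := fun i j =>
    (h2 i j).mono fun v hv => ⟨hv.1, hv.1.1, hv.2⟩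
  obtain ⟨v, hv⟩ := (h1 1).inter_inter_nonempty hH (h1 2) (h1 3) (h3 1 2) (h3 1 3) (h3 2 3)
  refine ⟨v, fun i => ?_⟩
  fin_cases i
  exacts [hv.2.1, hv.1.1.2, hv.1.2.2, hv.2.2]

end

end SimpleGraph

/-! ### Treewidth at most two excludes a `K₄` minor. -/

namespace Graph

/-- The simple graph of adjacencies of a loopless multigraph. -/
def simpleGraph {α : Type*} {β : Type*} (G : Graph α β) [G.Loopless] : SimpleGraph α where
  Adj := G.Adj
  symm := ⟨fun _ _ h => h.symm⟩
  loopless := ⟨G.not_adj_self⟩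

section

variable {α : Type*} {β : Type*} {G : Graph α β} [G.Loopless]

theorem simpleGraph_adj {x y : α} : G.simpleGraph.Adj x y ↔ G.Adj x y := Iff.rfl

/-- The bags containing a single vertex form a subtree, and the subtrees of adjacent vertices share
a bag; walking through `X` chains them together. -/
theorem TreeDecomposition.connectedOn_setOf_bag {ι : Type*} (D : G.TreeDecomposition ι)
    {X : Set α} (hX : G.simpleGraph.ConnectedOn X) :
    D.tree.ConnectedOn {i | (D.bag i ∩ X).Nonempty} := by
  have key : ∀ x y : α, ∀ w : G.simpleGraph.Walk x y, (∀ v ∈ w.support, v ∈ X) → ∀ i j,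
      x ∈ D.bag i → y ∈ D.bag j → D.tree.ReachableIn {i | (D.bag i ∩ X).Nonempty} i j := by
    intro x y w
    have base : ∀ x ∈ X, ∀ i j, x ∈ D.bag i → x ∈ D.bag j →
        D.tree.ReachableIn {i | (D.bag i ∩ X).Nonempty} i j := by
      intro x hx i j hi hj
      obtain ⟨p, hp⟩ := (D.isTree.connected i j).exists_isPath
      exact ⟨p, fun m hm => ⟨x, D.mem_bag_of_mem_path x i j hi hj p hp m hm, hx⟩⟩
    induction w with
    | nil => exact fun hw => base _ (hw _ (by simp))
    | @cons x x' y h p ih =>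
      intro hw i j hi hj
      obtain ⟨e, he⟩ := simpleGraph_adj.1 h
      obtain ⟨m, hm, hm'⟩ := D.exists_bag_of_isLink e _ _ he
      exact (base x (hw x (by simp)) i m hi hm).trans
        (ih (fun v hv => hw v (by simp [hv])) m j hm' hj)
  rintro i ⟨x, hxi, hx⟩ j ⟨y, hyj, hy⟩
  obtain ⟨w, hw⟩ := hX x hx y hy
  exact key x y w hw i j hxi hyj

/-- A graph of treewidth at most two has no complete minor on four vertices. -/
theorem false_of_four_connectedOn (htw : G.treewidth ≤ 2) (X : Fin 4 → Set α)
    (hX : ∀ i, G.simpleGraph.ConnectedOn (X i))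
    (hdisj : ∀ i j, i < j → Disjoint (X i) (X j))
    (hadj : ∀ i j, i < j → ∃ x ∈ X i, ∃ y ∈ X j, G.Adj x y) : False := by
  -- An infimum over the empty set would be `⊤`, so the bound guarantees a decomposition.
  have hne : {w : ℕ∞ | ∃ (ι : Type) (_ : Finite ι) (D : G.TreeDecomposition ι),
      D.width = w}.Nonempty := by
    by_contra h
    rw [Set.not_nonempty_iff_eq_empty] at h
    rw [treewidth, h, sInf_empty] at htw
    exact absurd htw (by decide)
  obtain ⟨ι, _, D, hD⟩ := csInf_mem hne
  have hw : D.width ≤ 2 := hD.trans_le htw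
  have hbag : ∀ i, (D.bag i).encard ≤ 3 := fun i => by
    refine (le_iSup (fun i => (D.bag i).encard) i).trans ?_
    have := tsub_le_iff_right.1 hw
    exact this.trans (by norm_num)
  have hinter : ∀ i j, i < j → ({m | (D.bag m ∩ X i).Nonempty} ∩
      {m | (D.bag m ∩ X j).Nonempty}).Nonempty := by
    intro i j hij
    obtain ⟨x, hx, y, hy, e, he⟩ := hadj i j hij
    obtain ⟨m, hm, hm'⟩ := D.exists_bag_of_isLink e _ _ he
    exact ⟨m, ⟨x, hm, hx⟩, ⟨y, hm', hy⟩⟩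
  obtain ⟨m, hm⟩ := SimpleGraph.exists_mem_of_four_connectedOn D.isTree.isAcyclic
    (fun i => {m | (D.bag m ∩ X i).Nonempty})
    (fun i => D.connectedOn_setOf_bag (hX i)) (by
      intro i j
      rcases lt_trichotomy i j with h | rfl | h
      · exact hinter i j h
      · obtain ⟨j, hj⟩ := exists_ne i
        rcases lt_or_gt_of_ne hj with h | h
        · exact (hinter _ _ h).mono fun v hv => ⟨hv.2, hv.2⟩
        · exact (hinter _ _ h).mono fun v hv => ⟨hv.1, hv.1⟩
      · rw [Set.inter_comm]; exact hinter j i h)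
  -- One bag meets all four disjoint sets, hence has four vertices instead of at most three.
  choose f hf using hm
  have hinj : Function.Injective f := by
    intro i j hij
    by_contra hne
    rcases lt_or_gt_of_ne hne with h | h
    · exact Set.disjoint_left.1 (hdisj _ _ h) (hf i).2 (hij ▸ (hf j).2)
    · exact Set.disjoint_left.1 (hdisj _ _ h) (hf j).2 (hij ▸ (hf i).2)
  have h4 : (Set.range f).encard = 4 := by
    rw [← Set.image_univ, hinj.encard_image, Set.encard_univ]; simp
  have := (Set.encard_le_encard (Set.range_subset_iff.2 fun i => (hf i).1)).trans (hbag m)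
  rw [h4] at this
  exact absurd this (by decide)

end

end Graph

/-! ### A cycle with two disjoint crossing connections has a `K₄` minor. -/

namespace SimpleGraph

/-- `x` and `y` are adjacent, or are both adjacent to a connected subset of `S \ C`. -/
def LinkedThrough {V : Type*} (H : SimpleGraph V) (S C : Set V) (x y : V) : Prop :=
  H.Adj x y ∨ ∃ J ⊆ S, Disjoint J C ∧ H.ConnectedOn J ∧
    (∃ z ∈ J, H.Adj x z) ∧ ∃ z ∈ J, H.Adj z y

section

variable {V : Type*} {H : SimpleGraph V} {S T C X Y : Set V} {x y z : V}

theorem ConnectedOn.union_of_mem (hS : H.ConnectedOn S) (hT : H.ConnectedOn T)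
    (hx : x ∈ S) (hx' : x ∈ T) : H.ConnectedOn (S ∪ T) := by
  have key : ∀ z ∈ S ∪ T, H.ReachableIn (S ∪ T) z x := by
    rintro z (hz | hz)
    · exact (hS z hz x hx).mono Set.subset_union_left
    · exact (hT z hz x hx').mono Set.subset_union_right
  exact fun z hz w hw => (key z hz).trans (key w hw).symm

theorem LinkedThrough.symm (h : H.LinkedThrough S C x y) : H.LinkedThrough S C y x := by
  rcases h with h | ⟨J, hJ, hJC, hJc, ⟨a, ha, hxa⟩, ⟨b, hb, hby⟩⟩
  · exact .inl h.symm
  · exact .inr ⟨J, hJ, hJC, hJc, ⟨b, hb, hby.symm⟩, ⟨a, ha, hxa.symm⟩⟩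

theorem LinkedThrough.exists_connectedOn (h : H.LinkedThrough S C x y) :
    ∃ J ⊆ S, Disjoint J C ∧ H.ConnectedOn ({x} ∪ J) ∧ ∃ z ∈ {x} ∪ J, H.Adj z y := by
  rcases h with h | ⟨J, hJ, hJC, hJc, ⟨a, ha, hxa⟩, ⟨b, hb, hby⟩⟩
  · exact ⟨∅, Set.empty_subset _, Set.empty_disjoint _, by simpa using ConnectedOn.singleton x,
      x, by simp, h⟩
  · exact ⟨J, hJ, hJC, (ConnectedOn.singleton x).union_of_adj hJc rfl ha hxa, b, .inr hb, hby⟩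

/-- A walk in `S` that starts in `X` and ends in `Y` contains a jump from `X` to `Y`. -/
theorem Walk.exists_linkedThrough (w : H.Walk x y) (hw : ∀ v ∈ w.support, v ∈ S)
    (hC : S ∩ C ⊆ X ∪ Y) (hXC : X ⊆ C) (hXY : Disjoint X Y)
    (hx : x ∈ X) (hy : y ∈ Y) : ∃ x ∈ X, ∃ y ∈ Y, H.LinkedThrough S C x y := by
  -- Invariant for an induction that starts at the far end of the walk: a jump has been found, or
  -- the current vertex is in `Y`, or it lies off `C` in a connected piece that is adjacent to `Y`.
  suffices h : (∃ x ∈ X, ∃ y ∈ Y, H.LinkedThrough S C x y) ∨ x ∈ Y ∨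
      (x ∉ C ∧ ∃ y ∈ Y, ∃ J ⊆ S, Disjoint J C ∧ H.ConnectedOn J ∧ x ∈ J ∧ ∃ z ∈ J, H.Adj z y) by
    rcases h with h | h | h
    · exact h
    · exact absurd h (Set.disjoint_left.1 hXY hx)
    · exact absurd (hXC hx) h.1
  clear hx
  induction w with
  | nil => exact .inr (.inl hy)
  | @cons x x' y h p ih =>
    have hxS : x ∈ S := hw x (by simp)
    rcases ih (fun v hv => hw v (by simp [hv])) hy with h1 | h1 | ⟨h1, y', hy', J, hJ, hJC, hJc, hxJ, hz⟩
    · exact .inl h1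
    · by_cases hxC : x ∈ C
      · rcases hC ⟨hxS, hxC⟩ with hx | hx
        · exact .inl ⟨x, hx, x', h1, .inl h⟩
        · exact .inr (.inl hx)
      · exact .inr (.inr ⟨hxC, x', h1, {x}, by simpa using hxS, by simpa using hxC,
          .singleton x, rfl, x, rfl, h⟩)
    · by_cases hxC : x ∈ C
      · rcases hC ⟨hxS, hxC⟩ with hx | hx
        · exact .inl ⟨x, hx, y', hy', .inr ⟨J, hJ, hJC, hJc, ⟨x', hxJ, h⟩, hz⟩⟩
        · exact .inr (.inl hx)
      · obtain ⟨z, hz, hzy⟩ := hz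
        refine .inr (.inr ⟨hxC, y', hy', {x} ∪ J, ?_, ?_, ?_, by simp, z, by simp [hz], hzy⟩)
        · exact Set.union_subset (by simpa using hxS) hJ
        · exact Set.disjoint_union_left.2 ⟨by simpa using hxC, hJC⟩
        · exact (ConnectedOn.singleton x).union_of_adj hJc rfl hxJ h

/-- Four disjoint connected sets, any two of which are joined by an edge. -/
def HasFourClique (H : SimpleGraph V) : Prop :=
  ∃ X : Fin 4 → Set V, (∀ i, H.ConnectedOn (X i)) ∧ (∀ i j, i < j → Disjoint (X i) (X j)) ∧
    ∀ i j, i < j → ∃ x ∈ X i, ∃ y ∈ X j, H.Adj x y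

theorem HasFourClique.mk' {A B C D : Set V} (hA : H.ConnectedOn A) (hB : H.ConnectedOn B)
    (hC : H.ConnectedOn C) (hD : H.ConnectedOn D)
    (hAB : Disjoint A B) (hAC : Disjoint A C) (hAD : Disjoint A D) (hBC : Disjoint B C)
    (hBD : Disjoint B D) (hCD : Disjoint C D)
    (jAB : ∃ x ∈ A, ∃ y ∈ B, H.Adj x y) (jAC : ∃ x ∈ A, ∃ y ∈ C, H.Adj x y)
    (jAD : ∃ x ∈ A, ∃ y ∈ D, H.Adj x y) (jBC : ∃ x ∈ B, ∃ y ∈ C, H.Adj x y)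
    (jBD : ∃ x ∈ B, ∃ y ∈ D, H.Adj x y) (jCD : ∃ x ∈ C, ∃ y ∈ D, H.Adj x y) :
    H.HasFourClique := by
  refine ⟨![A, B, C, D], ?_, ?_, ?_⟩
  · intro i
    fin_cases i <;> assumption
  · intro i j hij
    fin_cases i <;> fin_cases j <;> first | assumption | exact absurd hij (by decide)
  · intro i j hij
    fin_cases i <;> fin_cases j <;> first | assumption | exact absurd hij (by decide)

theorem disjoint_image_of_injOn {ι : Type*} {f : ι → V} {s A B : Set ι} (hf : Set.InjOn f s)
    (hA : A ⊆ s) (hB : B ⊆ s) (hAB : Disjoint A B) : Disjoint (f '' A) (f '' B) := by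
  rw [Set.disjoint_left]
  rintro _ ⟨a, ha, rfl⟩ ⟨b, hb, hab⟩
  exact Set.disjoint_left.1 hAB ha (hf (hB hb) (hA ha) hab ▸ hb)

variable {c : ℕ → V} {n : ℕ}

theorem connectedOn_image_Ico (hc : ∀ i < n, H.Adj (c i) (c (i + 1))) (a b : ℕ) (hb : b ≤ n) :
    H.ConnectedOn (c '' Set.Ico a b) := by
  induction b with
  | zero => simp [ConnectedOn]
  | succ b ih =>
    rcases lt_trichotomy a b with h | rfl | h
    · have hs : Set.Ico a (b + 1) = Set.Ico a b ∪ {b} := by ext; simp; omega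
      rw [hs, Set.image_union, Set.image_singleton]
      have := hc (b - 1) (by omega)
      rw [show b - 1 + 1 = b by omega] at this
      exact (ih (by omega)).union_of_adj (.singleton _)
        (Set.mem_image_of_mem _ (by simp; omega)) rfl this
    · have hs : Set.Ico a (a + 1) = {a} := by ext; simp; omega
      rw [hs, Set.image_singleton]
      exact .singleton _
    · have hs : Set.Ico a (b + 1) = ∅ := by ext; simp; omega
      rw [hs]; simp [ConnectedOn]

/-- The cycle is cut into four arcs beginning at `i`, `j`, `i'`, `j'`, the last one wrapping around
through `0`. Consecutive arcs are adjacent on the cycle; the connecting sets `J` and `K`, absorbed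
into the first two arcs, join the opposite ones. -/
theorem hasFourClique_of_linkedThrough (hc : ∀ i < n, H.Adj (c i) (c (i + 1)))
    (hcn : c n = c 0) (hinj : Set.InjOn c (Set.Iio n)) (hST : Disjoint S T) {i j i' j' : ℕ}
    (hij : i < j) (hji' : j < i') (hij' : i' < j') (hj' : j' < n)
    (hS : H.LinkedThrough S (c '' Set.Iio n) (c i) (c i'))
    (hT : H.LinkedThrough T (c '' Set.Iio n) (c j) (c j')) : H.HasFourClique := by
  obtain ⟨J, hJ, hJC, hJc, z, hz, hzi⟩ := hS.exists_connectedOn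
  obtain ⟨K, hK, hKC, hKc, u, hu, huj⟩ := hT.exists_connectedOn
  have hJK : Disjoint J K := hST.mono hJ hK
  have himg : ∀ {A B : Set ℕ}, (∀ a ∈ A, a < n) → (∀ b ∈ B, b < n) → Disjoint A B →
      Disjoint (c '' A) (c '' B) := fun hA hB hAB =>
    disjoint_image_of_injOn hinj hA hB hAB
  have hsub : ∀ {A : Set ℕ}, (∀ a ∈ A, a < n) → c '' A ⊆ c '' Set.Iio n := fun hA =>
    Set.image_mono hA
  have hJ' : ∀ {A : Set ℕ}, (∀ a ∈ A, a < n) → Disjoint J (c '' A) := fun hA =>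
    hJC.mono_right (hsub hA)
  have hK' : ∀ {A : Set ℕ}, (∀ a ∈ A, a < n) → Disjoint K (c '' A) := fun hA =>
    hKC.mono_right (hsub hA)
  have hpred : ∀ k, 0 < k → k ≤ n → H.Adj (c (k - 1)) (c k) := fun k hk hkn => by
    have := hc (k - 1) (by omega)
    rwa [Nat.sub_add_cancel hk] at this
  have hmem : ∀ {A : Set ℕ} {k : ℕ}, k ∈ A → c k ∈ c '' A := fun h => Set.mem_image_of_mem c h
  have hlast : H.Adj (c (n - 1)) (c 0) := hcn ▸ hpred n (by omega) le_rfl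
  have d : ∀ a b a' b' : ℕ, b ≤ a' → Disjoint (Set.Ico a b) (Set.Ico a' b') := fun a b a' b' h =>
    Set.disjoint_left.2 fun k hk hk' => by simp at hk hk'; omega
  have l : ∀ a b : ℕ, b ≤ n → ∀ k ∈ Set.Ico a b, k < n := fun a b h k hk => by
    simp at hk; omega
  refine HasFourClique.mk' (A := c '' Set.Ico i j ∪ J) (B := c '' Set.Ico j i' ∪ K)
    (C := c '' Set.Ico i' j') (D := c '' Set.Ico j' n ∪ c '' Set.Ico 0 i)
    ?_ ?_ ?_ ?_ ?_ ?_ ?_ ?_ ?_ ?_ ?_ ?_ ?_ ?_ ?_ ?_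
  · have h1 : c '' Set.Ico i j ∪ J = c '' Set.Ico i j ∪ ({c i} ∪ J) := by
      rw [← Set.union_assoc, Set.union_eq_self_of_subset_right (t := {c i})]
      simpa using ⟨i, by simp [hij], rfl⟩
    rw [h1]
    exact (connectedOn_image_Ico hc _ _ (by omega)).union_of_mem hJc
      (hmem (k := i) (by simp [hij])) (by simp)
  · have h1 : c '' Set.Ico j i' ∪ K = c '' Set.Ico j i' ∪ ({c j} ∪ K) := by
      rw [← Set.union_assoc, Set.union_eq_self_of_subset_right (t := {c j})]
      simpa using ⟨j, by simp [hji'], rfl⟩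
    rw [h1]
    exact (connectedOn_image_Ico hc _ _ (by omega)).union_of_mem hKc
      (hmem (k := j) (by simp [hji'])) (by simp)
  · exact connectedOn_image_Ico hc _ _ (by omega)
  -- For `i = 0` the wrapped piece of the last arc is empty.
  · rcases Nat.eq_zero_or_pos i with rfl | hi
    · simpa using connectedOn_image_Ico hc j' n le_rfl
    · exact (connectedOn_image_Ico hc _ _ le_rfl).union_of_adj
        (connectedOn_image_Ico hc _ _ (by omega)) (hmem (k := n - 1) (by simp; omega))
        (hmem (k := 0) (by simpa using hi)) hlast
  · simp only [Set.disjoint_union_left, Set.disjoint_union_right]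
    exact ⟨⟨himg (l _ _ (by omega)) (l _ _ (by omega)) (d _ _ _ _ le_rfl),
      hJ' (l _ _ (by omega))⟩, (hK' (l _ _ (by omega))).symm, hJK⟩
  · simp only [Set.disjoint_union_left]
    exact ⟨himg (l _ _ (by omega)) (l _ _ (by omega)) (d _ _ _ _ (by omega)),
      hJ' (l _ _ (by omega))⟩
  · simp only [Set.disjoint_union_left, Set.disjoint_union_right]
    exact ⟨⟨himg (l _ _ (by omega)) (l _ _ (by omega)) (d _ _ _ _ (by omega)),
      hJ' (l _ _ (by omega))⟩,
      himg (l _ _ (by omega)) (l _ _ (by omega)) (d _ _ _ _ (by omega)).symm,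
      hJ' (l _ _ (by omega))⟩
  · simp only [Set.disjoint_union_left]
    exact ⟨himg (l _ _ (by omega)) (l _ _ (by omega)) (d _ _ _ _ (by omega)),
      hK' (l _ _ (by omega))⟩
  · simp only [Set.disjoint_union_left, Set.disjoint_union_right]
    exact ⟨⟨himg (l _ _ (by omega)) (l _ _ (by omega)) (d _ _ _ _ (by omega)),
      hK' (l _ _ (by omega))⟩,
      himg (l _ _ (by omega)) (l _ _ (by omega)) (d _ _ _ _ (by omega)).symm,
      hK' (l _ _ (by omega))⟩
  · simp only [Set.disjoint_union_right]
    exact ⟨himg (l _ _ (by omega)) (l _ _ (by omega)) (d _ _ _ _ (by omega)),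
      himg (l _ _ (by omega)) (l _ _ (by omega)) (d _ _ _ _ (by omega)).symm⟩
  · exact ⟨c (j - 1), .inl (hmem (by simp; omega)), c j, .inl (hmem (by simp; omega)),
      hpred j (by omega) (by omega)⟩
  · refine ⟨z, ?_, c i', hmem (by simp; omega), hzi⟩
    rcases hz with rfl | hz
    · exact .inl (hmem (by simp; omega))
    · exact .inr hz
  · rcases Nat.eq_zero_or_pos i with rfl | hi
    · exact ⟨c 0, .inl (hmem (by simp; omega)), c (n - 1), .inl (hmem (by simp; omega)),
        hlast.symm⟩
    · exact ⟨c i, .inl (hmem (by simp; omega)), c (i - 1), .inr (hmem (by simp; omega)),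
        (hpred i hi (by omega)).symm⟩
  · exact ⟨c (i' - 1), .inl (hmem (by simp; omega)), c i', hmem (by simp; omega),
      hpred i' (by omega) (by omega)⟩
  · refine ⟨u, ?_, c j', .inl (hmem (by simp; omega)), huj⟩
    rcases hu with rfl | hu
    · exact .inl (hmem (by simp; omega))
    · exact .inr hu
  · exact ⟨c (j' - 1), hmem (by simp; omega), c j', .inl (hmem (by simp; omega)),
      hpred j' (by omega) (by omega)⟩

/-- Two disjoint sets that join crossing pairs of vertices of a cycle yield a complete minor on
four vertices. -/
theorem hasFourClique_of_crossing (hc : ∀ i < n, H.Adj (c i) (c (i + 1)))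
    (hcn : c n = c 0) (hinj : Set.InjOn c (Set.Iio n)) (hST : Disjoint S T) {i j i' j' : ℕ}
    (hij : i < j) (hji' : j < i') (hij' : i' < j') (hj' : j' < n)
    (hS : H.ReachableIn S (c i) (c i')) (hT : H.ReachableIn T (c j) (c j')) :
    H.HasFourClique := by
  have hne : ∀ {k m}, c k ∈ S → c m ∈ T → k ≠ m := by
    rintro k _ hk hm rfl
    exact Set.disjoint_left.1 hST hk hm
  -- Once `T` supplies a jump between `c a` and `c b`, the walk in `S` avoids both of these
  -- vertices, so it contains a jump between the two arcs they bound. The two jumps cross.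
  have key : ∀ a b r r', a < r → r < b → b < n → r' < n → r' < a ∨ b < r' → c a ∈ T → c b ∈ T →
      H.ReachableIn S (c r) (c r') → H.LinkedThrough T (c '' Set.Iio n) (c a) (c b) →
      H.HasFourClique := by
    rintro a b r r' har hrb hb hr' hab ha' hb' ⟨w, hw⟩ hl
    obtain ⟨_, ⟨p, hp, rfl⟩, _, ⟨q, hq, rfl⟩, hpq⟩ := w.exists_linkedThrough
      (C := c '' Set.Iio n) (X := c '' {k | a < k ∧ k < b})
      (Y := c '' {k | k < n ∧ (k < a ∨ b < k)}) hw (by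
        rintro _ ⟨hv, k, hk, rfl⟩
        have h1 := hne hv ha'
        have h2 := hne hv hb'
        by_cases h : a < k ∧ k < b
        · exact .inl ⟨k, h, rfl⟩
        · exact .inr ⟨k, ⟨hk, by omega⟩, rfl⟩)
      (Set.image_mono fun k hk => lt_trans hk.2 hb)
      (disjoint_image_of_injOn hinj (fun k hk => lt_trans hk.2 hb) (fun k hk => hk.1)
        (Set.disjoint_left.2 fun k ⟨_, _⟩ ⟨_, _⟩ => by omega))
      ⟨r, ⟨har, hrb⟩, rfl⟩ ⟨r', ⟨hr', hab⟩, rfl⟩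
    obtain ⟨hp1, hp2⟩ := hp
    obtain ⟨hq1, hq2 | hq2⟩ := hq
    · exact hasFourClique_of_linkedThrough hc hcn hinj hST hq2 hp1 hp2 hb hpq.symm hl
    · exact hasFourClique_of_linkedThrough hc hcn hinj hST.symm hp1 hp2 hq2 hq1 hl hpq
  -- The walk in `T` avoids `c i` and `c i'`, so it contains a jump between the two arcs they bound.
  -- Its ends are kept in `T`, as `key` requires.
  obtain ⟨w, hw⟩ := hT
  obtain ⟨_, ⟨p, hp, rfl⟩, _, ⟨q, hq, rfl⟩, hpq⟩ := w.exists_linkedThrough (C := c '' Set.Iio n)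
    (X := c '' {k | i < k ∧ k < i' ∧ c k ∈ T})
    (Y := c '' {k | k < n ∧ (k < i ∨ i' < k) ∧ c k ∈ T}) hw (by
      rintro _ ⟨hv, k, hk, rfl⟩
      have h1 := hne hS.left_mem hv
      have h2 := hne hS.right_mem hv
      by_cases h : i < k ∧ k < i'
      · exact .inl ⟨k, ⟨h.1, h.2, hv⟩, rfl⟩
      · exact .inr ⟨k, ⟨hk, by omega, hv⟩, rfl⟩)
    (Set.image_mono fun k hk => lt_trans hk.2.1 (hij'.trans hj'))
    (disjoint_image_of_injOn hinj (fun k hk => lt_trans hk.2.1 (hij'.trans hj'))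
      (fun k hk => hk.1) (Set.disjoint_left.2 fun k ⟨_, _, _⟩ ⟨_, _, _⟩ => by omega))
    ⟨j, ⟨hij, hji', hw _ w.start_mem_support⟩, rfl⟩
    ⟨j', ⟨hj', .inr hij', hw _ w.end_mem_support⟩, rfl⟩
  obtain ⟨hp1, hp2, hpT⟩ := hp
  obtain ⟨hqn, hq | hq, hqT⟩ := hq
  · exact key q p i i' hq hp1 (by omega) (by omega) (.inr hp2) hqT hpT hS hpq.symm
  · exact key p q i' i hp2 hq hqn (by omega) (.inl hp1) hpT hqT hS.symm hpq

end

end SimpleGraph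

/-! ### Menger's theorem for disjoint paths between two vertex sets. -/

namespace SimpleGraph

/-- There are `k` pairwise vertex-disjoint paths from `A` to `B`. -/
def HasDisjointPaths {V : Type*} (H : SimpleGraph V) (A B : Set V) (k : ℕ) : Prop :=
  ∃ (a b : Fin k → V) (p : ∀ i, H.Walk (a i) (b i)), (∀ i, a i ∈ A) ∧ (∀ i, b i ∈ B) ∧
    (∀ i, (p i).IsPath) ∧ ∀ i j, ∀ v ∈ (p i).support, v ∈ (p j).support → i = j

/-- Every walk from `A` to `B` meets `S`. -/
def Separates {V : Type*} (H : SimpleGraph V) (A B S : Set V) : Prop :=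
  ∀ a ∈ A, ∀ b ∈ B, ∀ w : H.Walk a b, ∃ v ∈ w.support, v ∈ S

/-- The vertices that can be reached from `A` by a walk avoiding `S`. -/
def reachSet {V : Type*} (H : SimpleGraph V) (A S : Set V) : Set V :=
  {v | ∃ a ∈ A, H.ReachableIn Sᶜ a v}

section

variable {V : Type*} {H H' : SimpleGraph V} {A B S : Set V} {x y u b : V} {k : ℕ}

theorem Separates.symm (h : H.Separates A B S) : H.Separates B A S := fun b hb a ha w => by
  simpa using h a ha b hb w.reverse

theorem Separates.disjoint_reachSet (h : H.Separates A B S) :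
    Disjoint (H.reachSet A S) (H.reachSet B S) := by
  rw [Set.disjoint_left]
  rintro v ⟨a, ha, h1⟩ ⟨b, hb, h2⟩
  obtain ⟨w, hw⟩ := h1.trans h2.symm
  obtain ⟨v, hv, hvS⟩ := h a ha b hb w
  exact hw v hv hvS

theorem HasDisjointPaths.mono (h : H'.HasDisjointPaths A B k) (hle : H' ≤ H) :
    H.HasDisjointPaths A B k := by
  obtain ⟨a, b, p, ha, hb, hp, hd⟩ := h
  exact ⟨a, b, fun i => (p i).mapLe hle, ha, hb, fun i => (hp i).mapLe hle, by simpa using hd⟩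

/-- Up to its first vertex in `insert x S`, a walk from `A` to `B` does not use the edge `xy`. -/
theorem exists_walk_avoiding_edge
    (hH' : ∀ u v, H.Adj u v → s(u, v) ≠ s(x, y) → H'.Adj u v) (hsep : H'.Separates A B S)
    (hy : y ∉ H'.reachSet A S) (w : H.Walk u b) (hb : b ∈ B)
    (hu : u ∈ H'.reachSet A S ∨ u ∈ S) :
    ∃ v ∈ insert x S, ∃ w' : H'.Walk u v, ∀ z ∈ w'.support,
      z ∈ w.support := by
  induction w with
  | nil =>
    rename_i u
    rcases hu with hu | hu
    · by_cases huS : u ∈ S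
      · exact ⟨u, by simp [huS], .nil, by simp⟩
      · exact absurd ⟨u, hb, .refl huS⟩ (Set.disjoint_left.1 hsep.disjoint_reachSet hu)
    · exact ⟨u, by simp [hu], .nil, by simp⟩
  | @cons u u' b h w ih =>
    rcases hu with hu | hu
    swap
    · exact ⟨u, by simp [hu], .nil, by simp⟩
    -- The current vertex is on the `A` side, which excludes `y`; the edge can only be met from `x`,
    -- where the walk is stopped.
    by_cases he : s(u, u') = s(x, y)
    · rcases Sym2.eq_iff.1 he with ⟨rfl, rfl⟩ | ⟨rfl, rfl⟩
      · exact ⟨u, by simp, .nil, by simp⟩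
      · exact absurd hu hy
    have hadj : H'.Adj u u' := hH' _ _ h he
    obtain ⟨v, hv, w', hw'⟩ := ih hb (by
      by_cases hu' : u' ∈ S
      · exact .inr hu'
      · obtain ⟨a, ha, har⟩ := hu
        exact .inl ⟨a, ha, har.trans (.of_adj hadj har.right_mem hu')⟩)
    refine ⟨v, hv, .cons hadj w', fun z hz => ?_⟩
    rw [Walk.support_cons, List.mem_cons] at hz ⊢
    exact hz.imp_right (hw' z)

/-- Disjoint paths from `A` onto a set `insert x S` of as many vertices meet `insert x S` only in
their ends. -/
theorem exists_end_of_card {X : Finset V} (hX : X.card = k) {a b : Fin k → V}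
    (p : ∀ i, H.Walk (a i) (b i)) (hb : ∀ i, b i ∈ X)
    (hd : ∀ i j, ∀ v ∈ (p i).support, v ∈ (p j).support → i = j) :
    (∀ v ∈ X, ∃ i, b i = v) ∧ ∀ i, ∀ v ∈ (p i).support, v ∈ X → v = b i := by
  classical
  have hinj : Function.Injective b := fun i j hij =>
    hd i j (b i) (p i).end_mem_support (by rw [hij]; exact (p j).end_mem_support)
  have himg : Finset.univ.image b = X := by
    apply Finset.eq_of_subset_of_card_le
    · simpa [Finset.image_subset_iff] using hb
    · rw [Finset.card_image_of_injective _ hinj]; simp [hX]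
  have hsurj : ∀ v ∈ X, ∃ i, b i = v := fun v hv => by
    rw [← himg] at hv
    simpa using hv
  refine ⟨hsurj, fun i v hv hvX => ?_⟩
  obtain ⟨j, rfl⟩ := hsurj v hvX
  rw [hd i j _ hv (p j).end_mem_support]

theorem Walk.IsPath.mem_reachSet {p : H.Walk u b} (hp : p.IsPath) (hu : u ∈ A)
    (h : ∀ v ∈ p.support, v ∈ S → v = b) {v : V} (hv : v ∈ p.support) (hvS : v ∉ S) :
    v ∈ H.reachSet A S := by
  classical
  refine ⟨u, hu, p.takeUntil v hv, fun z hz hzS => ?_⟩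
  obtain rfl := h z (p.support_takeUntil_subset_support hv hz) hzS
  by_cases hvb : v = z
  · exact hvS (hvb ▸ hzS)
  · exact Walk.endpoint_notMem_support_takeUntil hp hv (Ne.symm hvb) hz

/-- Menger's theorem: if no fewer than `k` vertices separate `A` from `B`, then there are `k`
disjoint paths from `A` to `B`. -/
theorem hasDisjointPaths_of_forall_separates (hH : H.edgeSet.Finite) (hA : A.Finite)
    (hB : B.Finite) (h : ∀ S : Finset V, H.Separates A B S → k ≤ S.card) :
    H.HasDisjointPaths A B k := by
  classical
  induction hm : H.edgeSet.ncard using Nat.strong_induction_on generalizing H A B with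
  | _ m ih =>
  subst hm
  rcases H.edgeSet.eq_empty_or_nonempty with h0 | ⟨e, he⟩
  · have hsub : H.Separates A B ((hA.inter_of_left B).toFinset : Set V) := by
      rintro a ha b hb w
      cases w with
      | nil => exact ⟨a, by simp, by simp [ha, hb]⟩
      | cons h _ => exact absurd ((mem_edgeSet H).2 h) (h0 ▸ Set.notMem_empty _)
    obtain ⟨T, hT, hTk⟩ := Finset.exists_subset_card_eq (h _ hsub)
    have e := T.equivFinOfCardEq hTk
    have hmem : ∀ i, (e.symm i : V) ∈ A ∩ B := fun i => by
      simpa using hT (e.symm i).2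
    refine ⟨fun i => e.symm i, fun i => e.symm i, fun i => .nil, fun i => (hmem i).1,
      fun i => (hmem i).2, by simp, fun i j v hi hj => ?_⟩
    simp only [Walk.support_nil, List.mem_singleton] at hi hj
    exact e.symm.injective (Subtype.ext (hi.symm.trans hj))
  -- either deleting an edge keeps the condition, or it creates a small separator
  by_cases hdel : ∀ S : Finset V, (H.deleteEdges {e}).Separates A B S → k ≤ S.card
  · refine (ih _ (Set.ncard_lt_ncard ?_ hH) (hH.subset ?_) hA hB hdel rfl).mono
      (deleteEdges_le _)
    · rw [edgeSet_deleteEdges]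
      exact ⟨Set.sdiff_subset, fun hs => (hs he).2 rfl⟩
    · rw [edgeSet_deleteEdges]
      exact Set.sdiff_subset
  push Not at hdel
  obtain ⟨S, hS, hSk⟩ := hdel
  -- `S` is too small to separate in `H`, so some walk avoids it; that walk can leave the `A` side
  -- only along `e`.
  have hex : ∃ x y, e = s(x, y) ∧ x ∈ (H.deleteEdges {e}).reachSet A S ∧
      y ∉ (H.deleteEdges {e}).reachSet A S := by
    have hnot : ¬ H.Separates A B S := fun hs => absurd (h S hs) (by omega)
    simp only [Separates, not_forall, not_exists, not_and] at hnot
    obtain ⟨a, ha, b, hb, w, hw⟩ := hnot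
    have hbS : b ∉ (H.deleteEdges {e}).reachSet A S := fun hbA =>
      Set.disjoint_left.1 hS.disjoint_reachSet hbA ⟨b, hb, .refl (hw b w.end_mem_support)⟩
    have haS : a ∈ (H.deleteEdges {e}).reachSet A S :=
      ⟨a, ha, .refl (hw a w.start_mem_support)⟩
    obtain ⟨d, hd, hd1, hd2⟩ := w.exists_boundary_dart _ haS hbS
    refine ⟨d.fst, d.snd, ?_, hd1, hd2⟩
    by_contra hne
    obtain ⟨a', ha', hr⟩ := hd1
    refine hd2 ⟨a', ha', hr.trans (.of_adj ?_ hr.right_mem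
      (hw _ (w.dart_snd_mem_support_of_mem_darts hd)))⟩
    rw [deleteEdges_adj]
    exact ⟨d.adj, fun h => hne h.symm⟩
  obtain ⟨x, y, rfl, hxA, hyA⟩ := hex
  set H' := H.deleteEdges {s(x, y)} with hH'
  have hxB : x ∉ H'.reachSet B S := Set.disjoint_left.1 hS.disjoint_reachSet hxA
  have hcard : H'.edgeSet.ncard < H.edgeSet.ncard := by
    refine Set.ncard_lt_ncard ?_ hH
    rw [hH', edgeSet_deleteEdges]
    exact ⟨Set.sdiff_subset, fun hs => (hs he).2 rfl⟩
  have hfin : H'.edgeSet.Finite := hH.subset (by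
    rw [hH', edgeSet_deleteEdges]; exact Set.sdiff_subset)
  have hstart : ∀ (A : Set V) a, a ∈ A → a ∈ H'.reachSet A S ∨ a ∈ (S : Set V) := fun A a ha => by
    by_cases haS : a ∈ (S : Set V)
    · exact .inr haS
    · exact .inl ⟨a, ha, .refl haS⟩
  have hadj : ∀ u v, H.Adj u v → s(u, v) ≠ s(x, y) → H'.Adj u v := fun u v h hne => by
    rw [hH', deleteEdges_adj]
    exact ⟨h, hne⟩
  have hX : ∀ Z : Finset V, H'.Separates A (insert x S : Finset V) Z → k ≤ Z.card := by
    refine fun Z hZ => h Z fun a ha b hb w => ?_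
    obtain ⟨v, hv, w', hw'⟩ := exists_walk_avoiding_edge hadj hS hyA w hb (hstart A a ha)
    obtain ⟨z, hz, hzZ⟩ := hZ a ha v (by simpa using hv) w'
    exact ⟨z, hw' z hz, hzZ⟩
  have hY : ∀ Z : Finset V, H'.Separates B (insert y S : Finset V) Z → k ≤ Z.card := by
    refine fun Z hZ => h Z (Separates.symm fun b hb a ha w => ?_)
    obtain ⟨v, hv, w', hw'⟩ := exists_walk_avoiding_edge (x := y) (y := x)
      (fun u v h hne => hadj u v h (by rwa [Sym2.eq_swap (a := x)])) hS.symm hxB w ha (hstart B b hb)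
    obtain ⟨z, hz, hzZ⟩ := hZ b hb v (by simpa using hv) w'
    exact ⟨z, hw' z hz, hzZ⟩
  -- A set separates itself from anything, so `insert x S` and `insert y S` have at least, and
  -- therefore exactly, `k` elements.
  have hself : ∀ (A : Set V) (Z : Finset V), H'.Separates A Z Z := fun A Z a _ z hz w =>
    ⟨z, w.end_mem_support, hz⟩
  have hXk : (insert x S).card = k :=
    le_antisymm ((Finset.card_insert_le _ _).trans hSk) (hX _ (hself _ _))
  have hYk : (insert y S).card = k :=
    le_antisymm ((Finset.card_insert_le _ _).trans hSk) (hY _ (hself _ _))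
  have hxS : x ∉ S := fun hx => by rw [Finset.insert_eq_of_mem hx] at hXk; omega
  have hyS : y ∉ S := fun hy => by rw [Finset.insert_eq_of_mem hy] at hYk; omega
  obtain ⟨a, c, p, ha, hc, hp, hpd⟩ := ih _ hcard hfin hA (Finset.finite_toSet _) hX rfl
  obtain ⟨b, d, q, hb, hd, hq, hqd⟩ := ih _ hcard hfin hB (Finset.finite_toSet _) hY rfl
  obtain ⟨-, hpX⟩ := exists_end_of_card hXk p hc hpd
  obtain ⟨hdY, hqY⟩ := exists_end_of_card hYk q hd hqd
  -- The two path systems are glued at the common vertices of `S`, and across the edge from `x` to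
  -- `y`.
  have hmatch : ∀ i, ∃ j, d j = if c i = x then y else c i := fun i => hdY _ (by
    by_cases h : c i = x
    · rw [if_pos h]
      exact Finset.mem_insert_self _ _
    · rw [if_neg h]
      exact Finset.mem_insert_of_mem ((Finset.mem_insert.1 (hc i)).resolve_left h))
  choose σ hσ using hmatch
  have hwalk : ∀ i, ∃ w : H.Walk (a i) (b (σ i)), w.IsPath ∧ ∀ v ∈ w.support,
      v ∈ (p i).support ∨ v ∈ (q (σ i)).support := by
    intro i
    have hle : H' ≤ H := deleteEdges_le _
    have hlink : ∃ w : H.Walk (c i) (d (σ i)), ∀ v ∈ w.support, v = c i ∨ v = d (σ i) := by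
      rw [hσ i]
      by_cases h : c i = x
      · rw [if_pos h, h]
        exact ⟨.cons ((mem_edgeSet H).1 he) .nil, by simp⟩
      · rw [if_neg h]
        exact ⟨.nil, by simp⟩
    obtain ⟨w, hw⟩ := hlink
    refine ⟨((((p i).mapLe hle).append w).append ((q (σ i)).mapLe hle).reverse).bypass,
      Walk.bypass_isPath _, fun v hv => ?_⟩
    have hv := Walk.support_bypass_subset_support _ hv
    simp only [Walk.mem_support_append_iff, Walk.support_reverse, List.mem_reverse,
      Walk.support_mapLe_eq_support] at hv
    rcases hv with (hv | hv) | hv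
    · exact .inl hv
    · rcases hw v hv with rfl | rfl
      · exact .inl (p i).end_mem_support
      · exact .inr (q (σ i)).end_mem_support
    · exact .inr hv
  choose w hw hwpq using hwalk
  have hσc : ∀ i j, σ i = σ j → i = j := fun i j hij => by
    have hcij : c i = c j := by
      have h1 := hσ i
      rw [hij, hσ j] at h1
      have hcS : ∀ i, c i ≠ x → c i ∈ S := fun i hi =>
        (Finset.mem_insert.1 (hc i)).resolve_left hi
      by_cases hi : c i = x <;> by_cases hj : c j = x
      · exact hi.trans hj.symm
      · rw [if_neg hj, if_pos hi] at h1
        exact absurd (h1 ▸ hcS j hj) hyS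
      · rw [if_pos hj, if_neg hi] at h1
        exact absurd (h1 ▸ hcS i hi) hyS
      · rw [if_neg hj, if_neg hi] at h1
        exact h1.symm
    exact hpd i j (c i) (p i).end_mem_support (by rw [hcij]; exact (p j).end_mem_support)
  -- A common vertex outside `S` would be reachable from both `A` and `B` while avoiding `S`.
  have hcross : ∀ i j v, v ∈ (p i).support → v ∈ (q (σ j)).support → i = j := by
    intro i j v hv hv'
    by_cases hvS : v ∈ S
    · have h1 := hpX i v hv (by simp [hvS])
      have h2 := hσ i
      rw [← h1, if_neg (by rintro rfl; exact hxS hvS)] at h2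
      exact hσc _ _ (hqd _ _ v (by rw [← h2]; exact (q (σ i)).end_mem_support) hv')
    · have h1 := (hp i).mem_reachSet (S := S) (ha i)
        (fun v hv hvS => hpX i v hv (Finset.mem_insert_of_mem hvS)) hv hvS
      have h2 := (hq (σ j)).mem_reachSet (S := S) (hb _)
        (fun v hv hvS => hqY _ v hv (Finset.mem_insert_of_mem hvS)) hv' hvS
      exact absurd h2 (Set.disjoint_left.1 hS.disjoint_reachSet h1)
  refine ⟨a, fun i => b (σ i), w, ha, fun i => hb _, hw, fun i j v hi hj => ?_⟩
  rcases hwpq i v hi with hi | hi <;> rcases hwpq j v hj with hj | hj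
  · exact hpd _ _ v hi hj
  · exact hcross _ _ v hi hj
  · exact (hcross _ _ v hj hi).symm
  · exact hσc _ _ (hqd _ _ v hi hj)

end

end SimpleGraph

/-! ### Walks in multigraphs and the two versions of Menger's theorem. -/

namespace Graph

section

variable {α : Type*} {β : Type*} {G : Graph α β} {s t x y z : α} {e f : β}

theorem Walk.support_eq_cons (p : G.Walk x y) : ∃ l, p.support = x :: l := by
  cases p <;> simp [Walk.support]

theorem Walk.support_eq_append (p : G.Walk x y) : ∃ l, p.support = l ++ [y] := by
  induction p with
  | nil x => exact ⟨[], rfl⟩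
  | cons e h p ih =>
    obtain ⟨l, hl⟩ := ih
    exact ⟨_, by rw [Walk.support, hl, List.cons_append]⟩

theorem Walk.support_eq_of_ne (p : G.Walk x y) (hxy : x ≠ y) :
    ∃ l, p.support = x :: (l ++ [y]) := by
  cases p with
  | nil => exact absurd rfl hxy
  | cons e h p =>
    obtain ⟨l, hl⟩ := p.support_eq_append
    exact ⟨l, by simp [Walk.support, hl]⟩

theorem Walk.start_mem_support (p : G.Walk x y) : x ∈ p.support := by
  obtain ⟨l, hl⟩ := p.support_eq_cons
  simp [hl]

theorem Walk.end_mem_support (p : G.Walk x y) : y ∈ p.support := by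
  obtain ⟨l, hl⟩ := p.support_eq_append
  simp [hl]

theorem Walk.mem_vertexSet (p : G.Walk x y) : ∀ v ∈ p.support, v ∈ G.vertexSet := by
  induction p with
  | nil x hx => simpa [Walk.support] using hx
  | cons e h p ih => simpa [Walk.support] using ⟨h.left_mem, ih⟩

theorem Walk.mem_edgeSet (p : G.Walk x y) : ∀ e ∈ p.edges, e ∈ G.edgeSet := by
  induction p with
  | nil x hx => simp [Walk.edges]
  | cons e h p ih => simpa [Walk.edges] using ⟨h.edge_mem, ih⟩

theorem Walk.mem_support_of_inc (p : G.Walk x y) (he : e ∈ p.edges) {v : α} (hv : G.Inc e v) :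
    v ∈ p.support := by
  induction p with
  | nil x hx => simp [Walk.edges] at he
  | cons f h p ih =>
    simp only [Walk.edges, List.mem_cons, Walk.support] at he ⊢
    rcases he with rfl | he
    · rcases hv.eq_or_eq_of_isLink h with rfl | rfl
      · exact .inl rfl
      · exact .inr p.start_mem_support
    · exact .inr (ih he)

theorem Walk.isChain_support (p : G.Walk x y) : p.support.IsChain G.Adj := by
  induction p with
  | nil x hx => simp [Walk.support]
  | cons e h p ih =>
    obtain ⟨l, hl⟩ := p.support_eq_cons
    rw [Walk.support, hl, List.isChain_cons_cons, ← hl]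
    exact ⟨h.adj, ih⟩

theorem Walk.exists_dropUntil (p : G.Walk x y) {v : α} (hv : v ∈ p.support) :
    ∃ q : G.Walk v y, q.support <:+ p.support ∧ q.edges ⊆ p.edges := by
  induction p with
  | nil x hx =>
    obtain rfl : v = x := by simpa [Walk.support] using hv
    exact ⟨.nil _ hx, List.suffix_rfl, by simp⟩
  | @cons x _ _ e h p ih =>
    by_cases hvx : v = x
    · subst hvx
      exact ⟨.cons e h p, List.suffix_rfl, by simp⟩
    · obtain ⟨q, hq, hq'⟩ := ih (by simpa [Walk.support, hvx] using hv)
      exact ⟨q, hq.trans (List.suffix_cons _ _), List.subset_cons_of_subset _ hq'⟩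

theorem Walk.exists_isPath (p : G.Walk x y) :
    ∃ q : G.Walk x y, q.IsPath ∧ q.support ⊆ p.support ∧ q.edges ⊆ p.edges := by
  induction p with
  | nil x hx => exact ⟨.nil x hx, by simp [Walk.IsPath, Walk.support], by simp, by simp⟩
  | @cons x _ _ e h p ih =>
    obtain ⟨q, hq, hqs, hqe⟩ := ih
    by_cases hx : x ∈ q.support
    · obtain ⟨r, hr, hre⟩ := q.exists_dropUntil hx
      exact ⟨r, hq.sublist hr.sublist,
        List.subset_cons_of_subset _ (List.Subset.trans hr.sublist.subset hqs),
        List.subset_cons_of_subset _ (List.Subset.trans hre hqe)⟩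
    · exact ⟨.cons e h q, List.nodup_cons.2 ⟨hx, hq⟩, List.cons_subset_cons _ hqs,
        List.cons_subset_cons _ hqe⟩

theorem Walk.exists_of_le {G' : Graph α β} (hle : G' ≤ G) (p : G'.Walk x y) :
    ∃ q : G.Walk x y, q.support = p.support ∧ q.edges = p.edges := by
  induction p with
  | nil x hx => exact ⟨.nil x (hle.vertexSet_mono hx), rfl, rfl⟩
  | cons e h p ih =>
    obtain ⟨q, hq, hq'⟩ := ih
    exact ⟨.cons e (IsLink.mono hle h) q, by simp [Walk.support, hq], by simp [Walk.edges, hq']⟩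

theorem isDisconnectingPair_of_forall_path {W : Set α} {F : Set β}
    (hW : W ⊆ G.vertexSet \ {s, t}) (hF : F ⊆ G.edgeSet)
    (h : ∀ p : G.Walk s t, p.IsPath → (∃ v ∈ p.support, v ∈ W) ∨ ∃ e ∈ p.edges, e ∈ F) :
    G.IsDisconnectingPair s t W F := by
  refine ⟨hW, hF, fun ⟨p, hp⟩ => ?_⟩
  obtain ⟨q, hq, hq'⟩ := p.exists_of_le (deleteEdges_le.trans deleteVerts_le)
  rcases h q (by rwa [Walk.IsPath, hq]) with ⟨v, hv, hvW⟩ | ⟨e, he, heF⟩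
  · have := p.mem_vertexSet v (hq ▸ hv)
    simp at this
    exact this.2 hvW
  · have := p.mem_edgeSet e (hq' ▸ he)
    simp at this
    exact this.2 heF

/-- A direct edge is a path without inner vertices, so only `F` can destroy it. -/
theorem IsDisconnectingPair.mem_of_isLink {W : Set α} {F : Set β}
    (h : G.IsDisconnectingPair s t W F) (hst : s ≠ t) (he : G.IsLink e s t) : e ∈ F := by
  by_contra heF
  have hs : s ∉ W := fun hs => (h.1 hs).2 (by simp)
  have ht : t ∉ W := fun ht => (h.1 ht).2 (by simp)
  have he' : ((G.deleteVerts W).deleteEdges F).IsLink e s t := by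
    simp [he, hs, ht, heF]
  exact h.2.2 ⟨.cons e he' (.nil t he'.right_mem), by simp [Walk.IsPath, Walk.support, hst]⟩

/-! ### Edge-disjoint paths -/

/-- The line graph on the edges in `R`. -/
def lineGraphOn (G : Graph α β) (R : Set β) : SimpleGraph β where
  Adj e f := e ≠ f ∧ (e ∈ R ∧ f ∈ R) ∧ ∃ v, G.Inc e v ∧ G.Inc f v
  symm := ⟨fun _ _ ⟨h, h', v, hv⟩ => ⟨h.symm, h'.symm, v, hv.symm⟩⟩
  loopless := ⟨fun _ h => h.1 rfl⟩

theorem Walk.exists_walk_lineGraphOn {R : Set β} (p : G.Walk x y) (hxy : x ≠ y)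
    (hp : ∀ e ∈ p.edges, e ∈ R) : ∃ e f, G.Inc e x ∧ G.Inc f y ∧
      ∃ w : (G.lineGraphOn R).Walk e f, ∀ g ∈ w.support, g ∈ p.edges := by
  induction p with
  | nil => exact absurd rfl hxy
  | @cons x x' y e h p ih =>
    simp only [Walk.edges, List.mem_cons, forall_eq_or_imp] at hp
    by_cases hx' : x' = y
    · subst hx'
      exact ⟨e, e, h.inc_left, h.inc_right, .nil, by simp [Walk.edges]⟩
    obtain ⟨e', f, he', hf, w, hw⟩ := ih hx' hp.2
    -- A walk may use the same edge twice in a row, which is no step in the line graph.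
    by_cases hee : e = e'
    · subst hee
      exact ⟨e, f, h.inc_left, hf, w, fun g hg => List.mem_cons_of_mem _ (hw g hg)⟩
    · have hadj : (G.lineGraphOn R).Adj e e' :=
        ⟨hee, ⟨hp.1, hp.2 _ (hw _ w.start_mem_support)⟩, x', h.inc_right, he'⟩
      refine ⟨e, f, h.inc_left, hf, .cons hadj w, fun g hg => ?_⟩
      rw [SimpleGraph.Walk.support_cons, List.mem_cons] at hg
      exact List.mem_cons.2 (hg.imp_right (hw g))

theorem Walk.exists_extend (p : G.Walk x y) (hx : G.Inc e x) (hz : G.Inc e z) :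
    ∃ q : G.Walk z y, q.edges ⊆ e :: p.edges := by
  by_cases hzx : z = x
  · subst hzx
    exact ⟨p, List.subset_cons_self _ _⟩
  · obtain ⟨w, hw⟩ := hz
    obtain rfl := hx.eq_of_isLink_of_ne_left hw.symm.symm (Ne.symm hzx)
    exact ⟨.cons e hw p, by simp [Walk.edges]⟩

theorem exists_walk_of_lineGraphOn {R : Set β} (w : (G.lineGraphOn R).Walk e f)
    (hx : G.Inc e x) (hy : G.Inc f y) : ∃ p : G.Walk x y, p.edges ⊆ w.support := by
  induction w generalizing x with
  | nil =>
    obtain ⟨q, hq⟩ := (Walk.nil y hy.vertex_mem : G.Walk y y).exists_extend hy hx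
    exact ⟨q, by simpa [Walk.edges] using hq⟩
  | cons h w ih =>
    have hh := h
    obtain ⟨_, _, v, hv, hv'⟩ := hh
    obtain ⟨p, hp⟩ := ih hv' hy
    obtain ⟨q, hq⟩ := p.exists_extend hv hx
    exact ⟨q, List.Subset.trans hq (by
      rw [SimpleGraph.Walk.support_cons]
      exact List.cons_subset_cons _ hp)⟩

theorem lineGraphOn_mem_of_mem_support {R : Set β} (w : (G.lineGraphOn R).Walk e f)
    (he : e ∈ R) : ∀ g ∈ w.support, g ∈ R := by
  induction w with
  | nil => simpa using he
  | cons h w ih => simpa using ⟨he, ih h.2.1.2⟩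

/-- The edge version of Menger's theorem. -/
theorem exists_edgeDisjoint_paths {R : Set β} (hR : R.Finite) (hst : s ≠ t) {n : ℕ}
    (h : ∀ F : Finset β, (∀ p : G.Walk s t, (∀ e ∈ p.edges, e ∈ R) → ∃ e ∈ p.edges, e ∈ F) →
      n ≤ F.card) :
    ∃ P : Fin n → G.Walk s t, (∀ i, (P i).IsPath) ∧ (∀ i, ∀ e ∈ (P i).edges, e ∈ R) ∧
      ∀ i j, i ≠ j → (P i).EdgeDisjoint (P j) := by
  have hfin : (G.lineGraphOn R).edgeSet.Finite := by
    refine ((hR.prod hR).image fun q => s(q.1, q.2)).subset fun e he => ?_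
    induction e with
    | h e f => exact ⟨(e, f), he.2.1, rfl⟩
  -- Vertices of the line graph are edges of `G`: disjoint paths from the edges at `s` to the edges
  -- at `t` give edge-disjoint `s`-`t` walks.
  obtain ⟨a, b, p, ha, hb, -, hd⟩ := SimpleGraph.hasDisjointPaths_of_forall_separates
    (A := {e | e ∈ R ∧ G.Inc e s}) (B := {e | e ∈ R ∧ G.Inc e t}) (k := n) hfin
    (hR.subset fun e he => he.1) (hR.subset fun e he => he.1) (by
      refine fun F hF => h F fun p hp => ?_
      obtain ⟨e, f, he, hf, w, hw⟩ := p.exists_walk_lineGraphOn hst hp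
      obtain ⟨g, hg, hgF⟩ := hF e ⟨hp e (hw _ w.start_mem_support), he⟩ f
        ⟨hp f (hw _ w.end_mem_support), hf⟩ w
      exact ⟨g, hw g hg, hgF⟩)
  have hP : ∀ i, ∃ q : G.Walk s t, q.IsPath ∧ q.edges ⊆ (p i).support := by
    intro i
    obtain ⟨q, hq⟩ := exists_walk_of_lineGraphOn (p i) (ha i).2 (hb i).2
    obtain ⟨r, hr, -, hr'⟩ := q.exists_isPath
    exact ⟨r, hr, List.Subset.trans hr' hq⟩
  choose P hP hPp using hP
  exact ⟨P, hP, fun i e he => lineGraphOn_mem_of_mem_support (p i) (ha i).1 e (hPp i he),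
    fun i j hij e hi hj => hij (hd i j e (hPp i hi) (hPp j hj))⟩

/-! ### Internally disjoint paths -/

variable [G.Loopless]

/-- The simple graph of adjacencies between vertices other than `s` and `t`. -/
def innerGraph (G : Graph α β) [G.Loopless] (s t : α) : SimpleGraph α where
  Adj x y := G.Adj x y ∧ (x ≠ s ∧ y ≠ s) ∧ x ≠ t ∧ y ≠ t
  symm := ⟨fun _ _ h => ⟨h.1.symm, h.2.1.symm, h.2.2.symm⟩⟩
  loopless := ⟨fun x h => G.not_adj_self x h.1⟩

theorem Walk.exists_walk_innerGraph (p : G.Walk x t) (hx : x ≠ t) (hs : s ∉ p.support) :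
    ∃ b, G.Adj b t ∧ b ≠ s ∧ ∃ w : (G.innerGraph s t).Walk x b,
      ∀ v ∈ w.support, v ∈ p.support ∧ v ≠ t := by
  induction p with
  | nil => exact absurd rfl hx
  | @cons x x' t e h p ih =>
    simp only [Walk.support, List.mem_cons, not_or] at hs
    by_cases hx' : x' = t
    · subst hx'
      exact ⟨x, h.adj, Ne.symm hs.1, .nil, by simp [Walk.support, hx]⟩
    obtain ⟨b, hb, hbs, w, hw⟩ := ih hx' hs.2
    have hx's : x' ≠ s := fun h => hs.2 (h ▸ p.start_mem_support)
    have hadj : (G.innerGraph s t).Adj x x' := ⟨h.adj, ⟨Ne.symm hs.1, hx's⟩, hx, hx'⟩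
    refine ⟨b, hb, hbs, .cons hadj w, fun v hv => ?_⟩
    rw [SimpleGraph.Walk.support_cons, List.mem_cons] at hv
    rcases hv with rfl | hv
    · exact ⟨by simp [Walk.support], hx⟩
    · exact ⟨List.mem_cons_of_mem _ (hw v hv).1, (hw v hv).2⟩

theorem exists_walk_of_innerGraph (w : (G.innerGraph s t).Walk x y) (hxs : x ≠ s) (hxt : x ≠ t)
    (hy : G.Adj y t) : ∃ p : G.Walk x t, p.support = w.support ++ [t] ∧
      (∀ e ∈ p.edges, ¬ G.IsLink e s t) ∧ s ∉ w.support ∧ t ∉ w.support := by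
  have key : ∀ {e x z}, x ≠ s → x ≠ t → G.IsLink e x z → ¬ G.IsLink e s t := by
    intro e x z hxs hxt h h'
    rcases h.left_eq_or_eq h' with h | h
    exacts [hxs h, hxt h]
  induction w with
  | nil =>
    obtain ⟨e, he⟩ := hy
    exact ⟨.cons e he (.nil t he.right_mem), by simp [Walk.support],
      by simpa [Walk.edges] using key hxs hxt he, by simpa using Ne.symm hxs,
      by simpa using Ne.symm hxt⟩
  | cons h w ih =>
    have hh := h
    obtain ⟨⟨e, he⟩, h1, h2⟩ := hh
    obtain ⟨p, hp, hpe, hs, ht⟩ := ih h1.2 h2.2 hy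
    exact ⟨.cons e he p, by simp [Walk.support, hp],
      by simpa [Walk.edges] using ⟨key hxs hxt he, hpe⟩,
      by simpa [hs] using Ne.symm hxs, by simpa [ht] using Ne.symm hxt⟩

/-- The vertex version of Menger's theorem, for paths that are not single edges. -/
theorem exists_internallyDisjoint_paths (hV : G.vertexSet.Finite) (hst : s ≠ t) {n : ℕ}
    (h : ∀ W : Finset α, (W : Set α) ⊆ G.vertexSet \ {s, t} →
      (∀ p : G.Walk s t, p.IsPath → (∀ e ∈ p.edges, ¬ G.IsLink e s t) →
        ∃ v ∈ p.support, v ∈ W) → n ≤ W.card) :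
    ∃ P : Fin n → G.Walk s t, (∀ i, (P i).IsPath) ∧
      (∀ i, ∀ e ∈ (P i).edges, ¬ G.IsLink e s t) ∧
      ∀ i j, i ≠ j → (P i).InternallyDisjoint (P j) := by
  classical
  have hfin : (G.innerGraph s t).edgeSet.Finite := by
    refine ((hV.prod hV).image fun q => s(q.1, q.2)).subset fun e he => ?_
    induction e with
    | h e f => exact ⟨(e, f), ⟨he.1.left_mem, he.1.right_mem⟩, rfl⟩
  -- Paths other than direct edges correspond to paths from the neighbours of `s` to those of `t`
  -- after both have been removed.
  obtain ⟨a, b, p, ha, hb, hp, hd⟩ := SimpleGraph.hasDisjointPaths_of_forall_separates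
    (A := {v | G.Adj s v ∧ v ≠ t}) (B := {v | G.Adj v t ∧ v ≠ s}) (k := n) hfin
    (hV.subset fun v hv => hv.1.right_mem) (hV.subset fun v hv => hv.1.left_mem) (by
      intro Z hZ
      refine (h (Z.filter fun v => v ∈ G.vertexSet \ {s, t})
        (fun v hv => (Finset.mem_filter.1 hv).2) ?_).trans
        (Finset.card_filter_le _ _)
      intro p hp hpe
      cases p with
      | nil => exact absurd rfl hst
      | @cons _ v _ e he p =>
        obtain ⟨hs, -⟩ := List.nodup_cons.1 hp
        have hv : v ≠ t := by
          rintro rfl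
          exact hpe e (by simp [Walk.edges]) he
        obtain ⟨b, hb, hbs, w, hw⟩ := p.exists_walk_innerGraph hv hs
        obtain ⟨z, hz, hzZ⟩ := hZ v ⟨he.adj, hv⟩ b ⟨hb, hbs⟩ w
        obtain ⟨hzp, hzt⟩ := hw z hz
        refine ⟨z, List.mem_cons_of_mem _ hzp, ?_⟩
        have hzs : z ≠ s := fun h => hs (h ▸ hzp)
        exact Finset.mem_filter.2 ⟨hzZ, p.mem_vertexSet z hzp, by simp [hzs, hzt]⟩)
  have hP : ∀ i, ∃ q : G.Walk s t, q.IsPath ∧ (∀ e ∈ q.edges, ¬ G.IsLink e s t) ∧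
      q.support = s :: ((p i).support ++ [t]) := by
    intro i
    obtain ⟨⟨e, he⟩, hat⟩ := ha i
    obtain ⟨q, hq, hqe, hqs, hqt⟩ := exists_walk_of_innerGraph (p i) he.ne.symm hat (hb i).1
    refine ⟨.cons e he q, ?_, ?_, by rw [Walk.support, hq]⟩
    · rw [Walk.IsPath, Walk.support, hq]
      have := (hp i).support_nodup
      simp only [List.nodup_cons, List.mem_append, List.mem_singleton, not_or,
        List.nodup_append, List.nodup_nil, List.not_mem_nil, not_false_eq_true]
      refine ⟨⟨hqs, hst⟩, this, by simp, ?_⟩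
      rintro v hv _ rfl rfl
      exact hqt hv
    · simp only [Walk.edges, List.mem_cons, forall_eq_or_imp]
      exact ⟨fun h => hat (he.right_unique h), hqe⟩
  choose P hP hPe hPs using hP
  refine ⟨P, hP, hPe, fun i j hij v hi hj => ?_⟩
  rw [hPs] at hi hj
  simp only [List.mem_cons, List.mem_append, List.not_mem_nil, or_false] at hi hj
  rcases hi with hi | hi | hi
  · exact .inl hi
  · rcases hj with hj | hj | hj
    · exact .inl hj
    · exact absurd (hd i j v hi hj) hij
    · exact .inr hj
  · exact .inr hi

end

end Graph

/-! ### Paths crossing a bond. -/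

namespace Graph

section

variable {α : Type*} {β : Type*} {G : Graph α β} {s t x y z : α} {e f : β}

/-- The edges with exactly one end in `T`. -/
def boundary (G : Graph α β) (T : Set α) : Set β :=
  {e | ∃ u v, G.IsLink e u v ∧ u ∈ T ∧ v ∉ T}

theorem IsLink.mem_boundary_iff {T : Set α} (h : G.IsLink e x y) :
    e ∈ G.boundary T ↔ (x ∈ T ∧ y ∉ T) ∨ (x ∉ T ∧ y ∈ T) := by
  constructor
  · rintro ⟨u, v, h', hu, hv⟩
    rcases h.eq_and_eq_or_eq_and_eq h' with ⟨rfl, rfl⟩ | ⟨rfl, rfl⟩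
    exacts [.inl ⟨hu, hv⟩, .inr ⟨hv, hu⟩]
  · rintro (⟨hx, hy⟩ | ⟨hx, hy⟩)
    exacts [⟨x, y, h, hx, hy⟩, ⟨y, x, h.symm, hy, hx⟩]

/-- A walk that does not leave `T` crosses the boundary of `T` at most once. -/
theorem Walk.boundary_subsingleton_or (p : G.Walk x y) (T : Set α) :
    (∃ l₁ l₂ u v, p.support = l₁ ++ u :: v :: l₂ ∧ u ∈ T ∧ v ∉ T) ∨
      (∀ e ∈ p.edges, ∀ f ∈ p.edges, e ∈ G.boundary T → f ∈ G.boundary T → e = f) ∧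
      (x ∈ T → ∀ e ∈ p.edges, e ∉ G.boundary T) := by
  -- The clause for walks starting in `T` drives the induction: once `T` is entered, no further
  -- boundary edge follows.
  induction p with
  | nil => exact .inr (by simp [Walk.edges])
  | @cons x x' y e h p ih =>
    rcases ih with ⟨l₁, l₂, u, v, hl, hu, hv⟩ | ⟨ih1, ih2⟩
    · exact .inl ⟨x :: l₁, l₂, u, v, by rw [Walk.support, hl, List.cons_append], hu, hv⟩
    have hb := h.mem_boundary_iff (T := T)
    by_cases hx : x ∈ T <;> by_cases hx' : x' ∈ T
    · right
      have he : e ∉ G.boundary T := by rw [hb]; tauto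
      have h2 : ∀ f ∈ (Walk.cons e h p).edges, f ∉ G.boundary T := by
        simpa [Walk.edges, he] using ih2 hx'
      exact ⟨fun f hf _ _ hf' _ => absurd hf' (h2 f hf), fun _ => h2⟩
    · obtain ⟨l, hl⟩ := p.support_eq_cons
      exact .inl ⟨[], l, x, x', by rw [Walk.support, hl, List.nil_append], hx, hx'⟩
    · refine .inr ⟨?_, fun h => absurd h hx⟩
      have h2 : ∀ f ∈ (Walk.cons e h p).edges, f ∈ G.boundary T → f = e := by
        intro f hf hfb
        rw [Walk.edges, List.mem_cons] at hf
        exact hf.resolve_right fun hf => ih2 hx' f hf hfb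
      exact fun f hf g hg hf' hg' => (h2 f hf hf').trans (h2 g hg hg').symm
    · refine .inr ⟨?_, fun h => absurd h hx⟩
      have he : e ∉ G.boundary T := by rw [hb]; tauto
      have h2 : ∀ f ∈ (Walk.cons e h p).edges, f ∈ G.boundary T → f ∈ p.edges := by
        intro f hf hfb
        rw [Walk.edges, List.mem_cons] at hf
        exact hf.resolve_left fun hf => he (hf ▸ hfb)
      exact fun f hf g hg hf' hg' => ih1 f (h2 f hf hf') g (h2 g hg hg') hf' hg'

/-- In a graph of treewidth at most two, one of two internally disjoint paths crosses a bond only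
once. -/
theorem Walk.boundary_subsingleton [G.Loopless] (htw : G.treewidth ≤ 2) (hst : s ≠ t)
    {p q : G.Walk s t} (hp : p.IsPath) (hq : q.IsPath) (hpq : p.InternallyDisjoint q)
    {S T : Set α} (hS : G.simpleGraph.ConnectedOn S) (hT : G.simpleGraph.ConnectedOn T)
    (hST : Disjoint S T) (hs : s ∈ S) (ht : t ∈ T)
    (hTS : ∀ u ∈ T, ∀ v ∉ T, G.Adj u v → v ∈ S) :
    ∀ e ∈ p.edges, ∀ f ∈ p.edges, e ∈ G.boundary T → f ∈ G.boundary T → e = f := by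
  rcases p.boundary_subsingleton_or T with ⟨l₁, l₂, u, v, hl, hu, hv⟩ | h
  swap
  · exact h.1
  exfalso
  have hsT : s ∉ T := Set.disjoint_left.1 hST hs
  have huv : G.Adj u v := by
    have := p.isChain_support
    rw [hl, List.isChain_append] at this
    exact (List.isChain_cons_cons.1 this.2.1).1
  -- Leaving `T` leads into `S`, so `s, u, v, t` occur along `p` in `S, T, S, T`.
  have hvS : v ∈ S := hTS u hu v hv huv
  have hvt : v ≠ t := fun h => hv (h ▸ ht)
  have hus : u ≠ s := fun h => hsT (h ▸ hu)
  obtain ⟨lp, hlp⟩ := p.support_eq_append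
  obtain ⟨m, hm⟩ := q.support_eq_of_ne hst
  have hqn : (s :: (m ++ [t])).Nodup := hm ▸ hq
  -- `L` lists once each vertex of the cycle made of `p` and the reversed `q`; appending `s` closes
  -- it.
  set L := p.support ++ m.reverse with hL
  have hLnd : L.Nodup := by
    simp only [List.nodup_cons, List.mem_append, List.mem_singleton, not_or,
      List.nodup_append] at hqn
    refine List.nodup_append.2 ⟨hp, List.nodup_reverse.2 hqn.2.1, ?_⟩
    rintro a ha b hb rfl
    rw [List.mem_reverse] at hb
    rcases hpq a ha (by simp [hm, hb]) with rfl | rfl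
    · exact hqn.1.1 hb
    · exact hqn.2.2.2 a hb a rfl rfl
  have hchain : (L ++ [s]).IsChain G.Adj := by
    have h1 := p.isChain_support
    have h2 : (t :: (m.reverse ++ [s])).IsChain G.Adj := by
      have h3 := q.isChain_support
      rw [hm] at h3
      have h4 := List.isChain_reverse.2 (h3.imp fun a b h => h.symm)
      simpa using h4
    rw [hL, hlp, List.append_assoc, List.append_assoc, List.singleton_append,
      List.isChain_split]
    exact ⟨hlp ▸ h1, h2⟩
  have hpl : p.support.length = l₁.length + l₂.length + 2 := by simp [hl]; omega
  have hlen : p.support.length ≤ L.length := by simp [hL]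
  have hget : ∀ i, i < p.support.length → (L ++ [s]).getD i s = p.support.getD i s := by
    intro i hi
    rw [List.getD_append _ _ _ _ (hi.trans_le hlen), hL, List.getD_append _ _ _ _ hi]
  have hc0 : (L ++ [s]).getD 0 s = s := by
    rw [hget 0 (by omega)]
    obtain ⟨l, hl⟩ := p.support_eq_cons
    rw [hl]; rfl
  have hcl : (L ++ [s]).getD (p.support.length - 1) s = t := by
    rw [hget _ (by omega), hlp]
    simp
  have hcu : (L ++ [s]).getD l₁.length s = u := by
    rw [hget _ (by omega), hl]
    simp
  have hcv : (L ++ [s]).getD (l₁.length + 1) s = v := by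
    rw [hget _ (by omega), hl]
    simp
  have hl1 : 0 < l₁.length := by
    rcases Nat.eq_zero_or_pos l₁.length with h | h
    · rw [h, hc0] at hcu
      exact absurd hcu.symm hus
    · exact h
  have hl2 : l₁.length + 1 < p.support.length - 1 := by
    by_contra hge
    rw [show p.support.length - 1 = l₁.length + 1 by omega, hcv] at hcl
    exact hvt hcl
  obtain ⟨X, hX1, hX2, hX3⟩ := SimpleGraph.hasFourClique_of_crossing (H := G.simpleGraph)
    (c := fun i => (L ++ [s]).getD i s) (n := L.length) (S := S) (T := T)
    (i := 0) (j := l₁.length) (i' := l₁.length + 1) (j' := p.support.length - 1)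
    (by
      intro i hi
      have := List.isChain_iff_getElem.1 hchain i (by simp; omega)
      rw [List.getD_eq_getElem _ _ (by simp; omega), List.getD_eq_getElem _ _ (by simp; omega)]
      exact this)
    (by simp only [hc0]; simp)
    (by
      intro i hi j hj hij
      simp only [Set.mem_Iio] at hi hj
      simp only [List.getD_append _ _ _ _ hi, List.getD_append _ _ _ _ hj,
        List.getD_eq_getElem _ _ hi, List.getD_eq_getElem _ _ hj] at hij
      exact (hLnd.getElem_inj_iff).1 hij)
    hST hl1 (by omega) hl2 (by omega)
    (by simp only [hc0, hcv]; exact hS s hs v hvS)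
    (by simp only [hcl, hcu]; exact hT u hu t ht)
  exact false_of_four_connectedOn htw X hX1 hX2 hX3

/-! ### Consequences of minimality of a connectivity pair. -/

/-- If `(k, l)` is a connectivity pair for `s` and `t`, then at least `k + l` edges separate
`s` from `t`. -/
theorem IsConnectivityPair.le_card [G.Loopless] {k l : ℕ} (h : G.IsConnectivityPair s t k l)
    (hst : s ≠ t) {F : Finset β} (hFE : (F : Set β) ⊆ G.edgeSet)
    (hF : ∀ p : G.Walk s t, p.IsPath → ∃ e ∈ p.edges, e ∈ F) : k + l ≤ F.card := by
  classical
  by_contra! hlt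
  obtain ⟨⟨W₀, F₀, hd₀, -, hF₀⟩, hmin⟩ := h
  have hmin : ∀ (W : Finset α) (F : Finset β), (W : Set α) ⊆ G.vertexSet \ {s, t} →
      (F : Set β) ⊆ G.edgeSet → (∀ p : G.Walk s t, p.IsPath →
        (∃ v ∈ p.support, v ∈ (W : Set α)) ∨ ∃ e ∈ p.edges, e ∈ (F : Set β)) →
      W.card ≤ k → F.card ≤ l → ¬ W.card + F.card < k + l := fun W F hW hF h h1 h2 h3 =>
    hmin ⟨W, F, isDisconnectingPair_of_forall_path hW hF h, h1, h2, h3⟩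
  by_cases hFl : F.card ≤ l
  · exact hmin ∅ F (by simp) hFE (fun p hp => .inr (hF p hp)) (by simp) hFl (by simpa using hlt)
  push Not at hFl
  -- Direct edges have no inner end to be traded for, but all of them belong to `F₀`, so they fit
  -- among the `l` edges that are kept.
  have hD : (F.filter fun e => G.IsLink e s t).card ≤ l := by
    refine hF₀ ▸ Finset.card_le_card fun e he => ?_
    exact hd₀.mem_of_isLink hst (Finset.mem_filter.1 he).2
  obtain ⟨F', hDF', hF'F, hF'l⟩ := Finset.exists_subsuperset_card_eq
    (Finset.filter_subset _ F) hD hFl.le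
  have hend : ∀ e : β, ∃ v, e ∈ F \ F' → G.Inc e v ∧ v ≠ s ∧ v ≠ t := by
    intro e
    by_cases he : e ∈ F \ F'
    · obtain ⟨heF, heF'⟩ := Finset.mem_sdiff.1 he
      obtain ⟨x, y, hxy⟩ := exists_isLink_of_mem_edgeSet (hFE heF)
      have hnst : ¬ G.IsLink e s t := fun h => heF' (hDF' (Finset.mem_filter.2 ⟨heF, h⟩))
      have hne := hxy.ne
      by_cases hx : x ≠ s ∧ x ≠ t
      · exact ⟨x, fun _ => ⟨hxy.inc_left, hx⟩⟩
      · refine ⟨y, fun _ => ⟨hxy.inc_right, ?_, ?_⟩⟩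
        · rintro rfl
          have : x = t := by tauto
          exact hnst (this ▸ hxy.symm)
        · rintro rfl
          have : x = s := by tauto
          exact hnst (this ▸ hxy)
    · exact ⟨s, fun h => absurd h he⟩
  choose g hg using hend
  have hN : (F \ F').card = F.card - l := by rw [Finset.card_sdiff_of_subset hF'F, hF'l]
  -- The other edges are replaced by inner ends, fewer than `k` in number.
  have hW : ((F \ F').image g).card ≤ F.card - l := hN ▸ Finset.card_image_le
  refine hmin ((F \ F').image g) F' ?_ (fun e he => hFE (hF'F he)) (fun p hp => ?_)
    (by omega) (by omega) (by omega)
  · intro v hv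
    obtain ⟨e, he, rfl⟩ := Finset.mem_image.1 hv
    obtain ⟨h1, h2, h3⟩ := hg e he
    exact ⟨h1.vertex_mem, by simp [h2, h3]⟩
  · obtain ⟨e, he, heF⟩ := hF p hp
    by_cases heF' : e ∈ F'
    · exact .inr ⟨e, he, heF'⟩
    · have hN := Finset.mem_sdiff.2 ⟨heF, heF'⟩
      exact .inl ⟨g e, p.mem_support_of_inc he (hg e hN).1, Finset.mem_image_of_mem g hN⟩

/-- A connectivity pair `(k, l)` with `l` positive yields `k + 1` internally disjoint paths. -/
theorem IsConnectivityPair.exists_internallyDisjoint [G.Loopless] {k l : ℕ}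
    (h : G.IsConnectivityPair s t k l) (hV : G.vertexSet.Finite) (hst : s ≠ t) (hl : 1 ≤ l) :
    ∃ P : Fin (k + 1) → G.Walk s t, (∀ i, (P i).IsPath) ∧
      (∀ i j, i ≠ j → (P i).EdgeDisjoint (P j)) ∧
      ∀ i j, i ≠ j → (P i).InternallyDisjoint (P j) := by
  classical
  obtain ⟨⟨W₀, F₀, hd₀, -, hF₀⟩, hmin⟩ := h
  have hED : ∀ p q : G.Walk s t, (∀ e ∈ p.edges, ¬ G.IsLink e s t) → p.InternallyDisjoint q →
      p.EdgeDisjoint q := by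
    intro p q hp hpq e he he'
    obtain ⟨x, y, hxy⟩ := exists_isLink_of_mem_edgeSet (p.mem_edgeSet e he)
    have hx := hpq x (p.mem_support_of_inc he hxy.inc_left) (q.mem_support_of_inc he' hxy.inc_left)
    have hy := hpq y (p.mem_support_of_inc he hxy.inc_right)
      (q.mem_support_of_inc he' hxy.inc_right)
    have hne := hxy.ne
    rcases hx with rfl | rfl <;> rcases hy with rfl | rfl
    · exact hne rfl
    · exact hp e he hxy
    · exact hp e he hxy.symm
    · exact hne rfl
  -- A direct edge serves as one path and only `k` others are needed: fewer than `k` vertices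
  -- meeting all of those, together with the direct edges in `F₀`, would contradict minimality.
  by_cases hD : ∃ e, G.IsLink e s t
  · obtain ⟨P, hP, hPe, hPd⟩ := exists_internallyDisjoint_paths hV hst (n := k) (by
      intro W hW h
      by_contra! hlt
      refine hmin ⟨W, F₀.filter fun e => G.IsLink e s t,
        isDisconnectingPair_of_forall_path hW ?_ ?_, hlt.le, hF₀ ▸ Finset.card_filter_le _ _, ?_⟩
      · intro e he
        exact (Finset.mem_filter.1 he).2.edge_mem
      · intro p hp
        by_cases hpe : ∀ e ∈ p.edges, ¬ G.IsLink e s t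
        · exact .inl (h p hp hpe)
        · push Not at hpe
          obtain ⟨e, he, hes⟩ := hpe
          exact .inr ⟨e, he, Finset.mem_filter.2 ⟨hd₀.mem_of_isLink hst hes, hes⟩⟩
      · have := Finset.card_filter_le F₀ fun e => G.IsLink e s t
        omega)
    obtain ⟨e, he⟩ := hD
    set d : G.Walk s t := .cons e he (.nil t he.right_mem) with hd
    have hds : ∀ v ∈ d.support, v = s ∨ v = t := by simp [hd, Walk.support]
    have hde : ∀ f ∈ d.edges, f = e := by simp [hd, Walk.edges]
    refine ⟨Fin.cons d P, Fin.cases ?_ hP, Fin.cases (Fin.cases ?_ ?_) fun i => Fin.cases ?_ ?_,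
      Fin.cases (Fin.cases ?_ ?_) fun i => Fin.cases ?_ ?_⟩
    · simp [hd, Walk.IsPath, Walk.support, hst]
    · exact fun h => absurd rfl h
    · intro i _ f hf hf'
      obtain rfl := hde f hf
      exact hPe i f hf' he
    · intro _ f hf hf'
      obtain rfl := hde f hf'
      exact hPe i f hf he
    · intro j hij
      exact hED _ _ (hPe i) (hPd i j fun h => hij (h ▸ rfl))
    · exact fun h => absurd rfl h
    · exact fun i _ v hv _ => hds v hv
    · exact fun _ v _ hv => hds v hv
    · exact fun j hij => hPd i j fun h => hij (h ▸ rfl)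
  -- Here at most `k` vertices meeting every path would form a smaller pair with no edges at all,
  -- because `l ≥ 1`.
  · obtain ⟨P, hP, hPe, hPd⟩ := exists_internallyDisjoint_paths hV hst (n := k + 1) (by
      intro W hW h
      by_contra! hlt
      refine hmin ⟨W, ∅, isDisconnectingPair_of_forall_path hW (by simp) fun p hp => .inl
        (h p hp fun e _ he => hD ⟨e, he⟩), by omega, by simp, by simp; omega⟩)
    exact ⟨P, hP, fun i j hij => hED _ _ (hPe i) (hPd i j hij), hPd⟩

/-! ### Edge-disjoint paths outside the internally disjoint ones. -/

theorem Walk.exists_concat (p : G.Walk x y) (h : G.IsLink e y z) :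
    ∃ q : G.Walk x z, q.edges ⊆ e :: p.edges := by
  induction p with
  | nil x hx => exact ⟨.cons e h (.nil z h.right_mem), by simp [Walk.edges]⟩
  | cons f h' p ih =>
    obtain ⟨q, hq⟩ := ih h
    exact ⟨.cons f h' q, List.cons_subset.2 ⟨by simp [Walk.edges],
      List.Subset.trans hq (List.cons_subset_cons _ (List.subset_cons_self _ _))⟩⟩

theorem Walk.exists_mem_boundary (p : G.Walk x y) {T : Set α} (hx : x ∉ T) (hy : y ∈ T) :
    ∃ e ∈ p.edges, e ∈ G.boundary T := by
  induction p with
  | nil => exact absurd hy hx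
  | @cons x x' y e h p ih =>
    by_cases hx' : x' ∈ T
    · exact ⟨e, by simp [Walk.edges], x', x, h.symm, hx', hx⟩
    · obtain ⟨f, hf, hfT⟩ := ih hx' hy
      exact ⟨f, List.mem_cons_of_mem _ hf, hfT⟩

/-- The vertices reached from `x` by walks with all edges in `K`. -/
def edgeReachSet (G : Graph α β) (K : Set β) (x : α) : Set α :=
  {v | ∃ p : G.Walk x v, ∀ e ∈ p.edges, e ∈ K}

theorem Walk.reachableIn_edgeReachSet [G.Loopless] {K : Set β} (p : G.Walk x y)
    (hp : ∀ e ∈ p.edges, e ∈ K) : G.simpleGraph.ReachableIn (G.edgeReachSet K x) x y := by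
  induction p with
  | nil x hx => exact .refl ⟨.nil x hx, by simp [Walk.edges]⟩
  | @cons x x' y e h p ih =>
    simp only [Walk.edges, List.mem_cons, forall_eq_or_imp] at hp
    have hsub : G.edgeReachSet K x' ⊆ G.edgeReachSet K x := fun v ⟨q, hq⟩ =>
      ⟨.cons e h q, by simpa [Walk.edges] using ⟨hp.1, hq⟩⟩
    have h' := (ih hp.2).mono hsub
    exact .trans (.of_adj h.adj ⟨.nil x h.left_mem, by simp [Walk.edges]⟩ h'.left_mem) h'

theorem connectedOn_edgeReachSet [G.Loopless] (K : Set β) (x : α) :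
    G.simpleGraph.ConnectedOn (G.edgeReachSet K x) := by
  rintro a ⟨p, hp⟩ b ⟨q, hq⟩
  exact (p.reachableIn_edgeReachSet hp).symm.trans (q.reachableIn_edgeReachSet hq)

theorem _root_.SimpleGraph.connectedOn_setOf_reachableIn {H : SimpleGraph α} (C : Set α) (x : α) :
    H.ConnectedOn {v | H.ReachableIn C x v} := by
  classical
  have key : ∀ a, H.ReachableIn C x a → H.ReachableIn {v | H.ReachableIn C x v} x a := by
    rintro a ⟨w, hw⟩
    exact ⟨w, fun v hv => ⟨w.takeUntil v hv, fun z hz =>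
      hw z (w.support_takeUntil_subset_support hv hz)⟩⟩
  exact fun a ha b hb => (key a ha).symm.trans (key b hb)

/-- The edges outside `k + 1` internally disjoint paths contain enough edge-disjoint paths. -/
theorem exists_edgeDisjoint_paths_compl [G.Loopless] (hE : G.edgeSet.Finite)
    (htw : G.treewidth ≤ 2) (hst : s ≠ t) {k n m : ℕ} (hk : 1 ≤ k)
    (P : Fin (k + 1) → G.Walk s t) (hP : ∀ i, (P i).IsPath)
    (hPd : ∀ i j, i ≠ j → (P i).InternallyDisjoint (P j)) (hnm : n + (k + 1) ≤ m)
    (hm : ∀ F : Finset β, (F : Set β) ⊆ G.edgeSet →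
      (∀ p : G.Walk s t, p.IsPath → ∃ e ∈ p.edges, e ∈ F) → m ≤ F.card) :
    ∃ Q : Fin n → G.Walk s t, (∀ i, (Q i).IsPath) ∧
      (∀ i, ∀ e ∈ (Q i).edges, ∀ j, e ∉ (P j).edges) ∧
      ∀ i j, i ≠ j → (Q i).EdgeDisjoint (Q j) := by
  classical
  set R : Set β := {e | e ∈ G.edgeSet ∧ ∀ j, e ∉ (P j).edges} with hR
  obtain ⟨Q, hQ, hQR, hQd⟩ := exists_edgeDisjoint_paths (G := G) (s := s) (t := t) (R := R)
    (hE.subset fun e he => he.1) hst (n := n) (by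
    intro F hF
    set S := G.edgeReachSet (R \ F) s with hS
    set T := {v | G.simpleGraph.ReachableIn Sᶜ t v} with hT
    have hs : s ∈ S := ⟨.nil s ((P 0).mem_vertexSet _ (P 0).start_mem_support), by
      simp [Walk.edges]⟩
    have htS : t ∉ S := fun ⟨p, hp⟩ => by
      obtain ⟨e, he, heF⟩ := hF p fun e he => (hp e he).1
      exact (hp e he).2 heF
    have ht : t ∈ T := .refl htS
    have hST : Disjoint S T := Set.disjoint_left.2 fun v hv hvT => hvT.right_mem hv
    -- `T` is a whole component of the complement of `S`, so its boundary is a bond between two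
    -- connected sets.
    have hTS : ∀ u ∈ T, ∀ v ∉ T, G.Adj u v → v ∈ S := by
      intro u hu v hv huv
      by_contra hvS
      exact hv (hu.trans (.of_adj huv hu.right_mem hvS))
    set B := (hE.subset fun e (he : e ∈ G.boundary T) => by
      obtain ⟨u, v, h, -⟩ := he; exact h.edge_mem : (G.boundary T).Finite).toFinset with hB
    have hmB : m ≤ B.card := hm B (fun e he => by
        obtain ⟨u, v, h, -⟩ := (Set.Finite.mem_toFinset _).1 he; exact h.edge_mem)
      fun p _ => by
        simpa [hB] using p.exists_mem_boundary (Set.disjoint_left.1 hST hs) ht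
    -- A boundary edge outside `F` and all the `P j` would extend the part reached from `s` into
    -- `T`.
    have hBsub : B ⊆ F ∪ Finset.univ.biUnion fun j => B.filter fun e => e ∈ (P j).edges := by
      intro e he
      obtain ⟨u, v, huv, hu, hv⟩ := (Set.Finite.mem_toFinset _).1 he
      by_cases heP : ∃ j, e ∈ (P j).edges
      · obtain ⟨j, hj⟩ := heP
        exact Finset.mem_union_right _ (Finset.mem_biUnion.2
          ⟨j, Finset.mem_univ _, Finset.mem_filter.2 ⟨he, hj⟩⟩)
      · refine Finset.mem_union_left _ ?_
        by_contra heF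
        push Not at heP
        obtain ⟨p, hp⟩ := hTS u hu v hv huv.adj
        obtain ⟨q, hq⟩ := p.exists_concat huv.symm
        refine Set.disjoint_left.1 hST ⟨q, fun f hf => ?_⟩ hu
        rcases List.mem_cons.1 (hq hf) with rfl | hf
        exacts [⟨⟨huv.edge_mem, heP⟩, heF⟩, hp f hf]
    have hone : ∀ j, (B.filter fun e => e ∈ (P j).edges).card ≤ 1 := by
      intro j
      -- `k ≥ 1` supplies a second path to close `P j` up to a cycle.
      have : Nontrivial (Fin (k + 1)) := Fin.nontrivial_iff_two_le.2 (by omega)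
      obtain ⟨i, hij⟩ := exists_ne j
      refine Finset.card_le_one.2 fun e he f hf => ?_
      obtain ⟨heB, hej⟩ := Finset.mem_filter.1 he
      obtain ⟨hfB, hfj⟩ := Finset.mem_filter.1 hf
      exact Walk.boundary_subsingleton htw hst (hP j) (hP i) (hPd j i hij.symm)
        (connectedOn_edgeReachSet _ s) (SimpleGraph.connectedOn_setOf_reachableIn _ t) hST hs ht
        hTS e hej f hfj ((Set.Finite.mem_toFinset _).1 heB) ((Set.Finite.mem_toFinset _).1 hfB)
    have hcard := (Finset.card_le_card hBsub).trans (Finset.card_union_le _ _)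
    have hbi := Finset.card_biUnion_le_card_mul Finset.univ
      (fun j => B.filter fun e => e ∈ (P j).edges) 1 fun j _ => hone j
    simp only [Finset.card_univ, Fintype.card_fin, mul_one] at hbi
    omega)
  exact ⟨Q, hQ, fun i e he => (hQR i e he).2, hQd⟩

end

end Graph

/-! ### Assembling the two path systems. -/

theorem mainTheorem4 {α : Type*} {β : Type*} (G : Graph α β) [G.Loopless]
    (hV : G.vertexSet.Finite) (hE : G.edgeSet.Finite) (htw : G.treewidth ≤ 2)
    (s t : α) (hs : s ∈ G.vertexSet) (ht : t ∈ G.vertexSet) (hst : s ≠ t)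
    (k l : ℕ) (hl : 1 ≤ l) (hkl : G.IsConnectivityPair s t k l) :
    ∃ P : Fin (k + l) → G.Walk s t,
      (∀ i, (P i).IsPath) ∧
      (∀ i j, i ≠ j → (P i).EdgeDisjoint (P j)) ∧
      ∃ I : Finset (Fin (k + l)), I.card = k + 1 ∧
        ∀ i ∈ I, ∀ j ∈ I, i ≠ j → (P i).InternallyDisjoint (P j) := by
  classical
  have hcut := fun F hFE hF => hkl.le_card hst (F := F) hFE hF
  rcases Nat.eq_zero_or_pos k with rfl | hk
  -- For `k = 0` internal disjointness concerns a single path, so `l` edge-disjoint paths are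
  -- enough.
  · obtain ⟨P, hP, -, hPd⟩ := Graph.exists_edgeDisjoint_paths (G := G) (R := G.edgeSet) hE hst
      (n := 0 + l) (by
      intro F hF
      refine (hcut (F.filter fun e => e ∈ G.edgeSet) (fun e he => (Finset.mem_filter.1 he).2)
        fun p _ => ?_).trans (Finset.card_filter_le _ _)
      obtain ⟨e, he, heF⟩ := hF p p.mem_edgeSet
      exact ⟨e, he, Finset.mem_filter.2 ⟨heF, p.mem_edgeSet e he⟩⟩)
    refine ⟨P, hP, hPd, {⟨0, by omega⟩}, by simp, fun i hi j hj hij => ?_⟩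
    exact absurd ((Finset.mem_singleton.1 hi).trans (Finset.mem_singleton.1 hj).symm) hij
  · obtain ⟨P, hP, hPe, hPd⟩ := hkl.exists_internallyDisjoint hV hst hl
    -- `m = l - 1` further paths are needed beyond the `k + 1` already found.
    obtain ⟨m, rfl⟩ := Nat.exists_eq_add_of_le hl
    obtain ⟨Q, hQ, hQP, hQd⟩ := Graph.exists_edgeDisjoint_paths_compl hE htw hst hk P hP hPd
      (n := m) (m := k + (1 + m)) (by omega) hcut
    rw [← Nat.add_assoc]
    refine ⟨Fin.append P Q, fun i => ?_, fun i j hij => ?_,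
      Finset.univ.map (Fin.castAddEmb m), by simp, ?_⟩
    · induction i using Fin.addCases with
      | left i => simpa using hP i
      | right i => simpa using hQ i
    · induction i using Fin.addCases with
      | left i =>
        induction j using Fin.addCases with
        | left j => simpa using hPe i j fun h => hij (h ▸ rfl)
        | right j =>
          simp only [Fin.append_left, Fin.append_right]
          exact fun e he he' => hQP j e he' i he
      | right i =>
        induction j using Fin.addCases with
        | left j =>
          simp only [Fin.append_left, Fin.append_right]
          exact fun e he he' => hQP i e he j he'
        | right j => simpa using hQd i j fun h => hij (h ▸ rfl)
    · intro i hi j hj hij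
      obtain ⟨i, -, rfl⟩ := Finset.mem_map.1 hi
      obtain ⟨j, -, rfl⟩ := Finset.mem_map.1 hj
      simpa using hPd i j fun h => hij (h ▸ rfl)
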